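/- Let $D\ge 1$ be an integer that is not a perfect square, let $\Gamma=\mathrm{SL}_2(\mathbb Z)$, let $\eta=(-\sqrt D,\sqrt D)$, and let $\Gamma_\eta$ be the subgroup of all elements of $\Gamma$ that fix both $-\sqrt D$ and $\sqrt D$ under linear fractional transformations. Let $(a_0,c_0)$ be the positive integer solution of $a^2-Dc^2=1$ with $a_0>1$ minimal, and put $\varepsilon_D=a_0+c_0\sqrt D$ and $\ell_\eta=2\log\varepsilon_D$. Put $$\sigma_\eta=\frac{1}{\sqrt{2\sqrt D}}\begin{pmatrix}\sqrt D&-\sqrt D\\1&1\end{pmatrix},\qquad C_{\eta\eta}=\Bigl\{ad\ :\ \begin{pmatrix}a&b\\c&d\end{pmatrix}\in\sigma_\eta^{-1}\Gamma\sigma_\eta,\ abcd\neq 0\Bigr\}.$$ For $C\in C_{\eta\eta}$, $\alpha\in\{1,-1\}$ and $m,n\in\mathbb Z$ let $$S^\star(m,n;C,\alpha)=\sum \exp\Bigl(2\pi i\Bigl[\frac{m}{\ell_\eta}\log\Bigl(\frac ac\Bigr)+\frac{n}{\ell_\eta}\log\Bigl(-\frac cd\Bigr)\Bigr]\Bigr),$$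 summed over the double cosets $\Gamma_\eta\gamma\Gamma_\eta$ in $\Gamma_\eta\backslash\Gamma/\Gamma_\eta$ for which $\begin{pmatrix}a&b\\c&d\end{pmatrix}=\sigma_\eta^{-1}\gamma\sigma_\eta$ satisfies $ad=C$ and $\operatorname{sgn}(ac)=\alpha$. In particular, $S^\star(0,0;C,\alpha)$ is the number of these double cosets. Let ${}_2F_1(a,b;c;1-z)$ denote the principal branch, $-\pi<\arg z\le\pi$, of the hypergeometric function; so for real $x>1$, ${}_2F_1(a,b;c;x)=\lim_{t\to0^+}{}_2F_1(a,b;c;x-it)$. With $m=n=0$ and weight $k=10$, let $$\Sigma_1=\sum_{C\in C_{\eta\eta},\ C\notin(0,1)}{}_2F_1\Bigl(5,5;10;\frac1C\Bigr)\frac{S^\star(0,0;C,1)+S^\star(0,0;C,-1)}{C^5},$$ $$\Sigma_2=\sum_{C\in C_{\eta\eta}\cap(0,1)}{}_2F_1\Bigl(5,5;10;\frac1C\Bigr)\frac{S^\star(0,0;C,1)}{C^5},$$ $$\Sigma_3=\sum_{C\in C_{\eta\eta}\cap(0,1)}{}_2F_1\Bigl(5,5;10;\frac{-1}{C-1}\Bigr)\frac{S^\star(0,0;C,-1)}{(C-1)^5},$$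 $$\Phi(D)=\frac{1}{1260\log\varepsilon_D}\,(\Sigma_1+\Sigma_2+\Sigma_3).$$ **Proposition.** The sums $S^\star(0,0;C,\alpha)$, $\Sigma_2$ and $\Sigma_3$ are finite sums and $\Sigma_1$ converges absolutely. The function $\Phi(D)$ takes only the values $0$ and $-1$. The equation $x^2-Dy^2=-1$ has integer solutions $x,y$ if and only if $\Phi(D)=0$. -/

import Mathlib

open Complex Filter Topology MatrixGroups

noncomputable section

/-- `F` is the principal branch of the Gauss hypergeometric function `₂F₁(a, b; c; ·)`: it is given
by the hypergeometric series on the unit disc and holomorphic on the plane cut along `[1, ∞)`.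
The branch is the one in which `1 - z` has argument in `(-π, π]`; so a value on the cut, where
`1 - x < 0` has argument `π`, is the limit through points `z` with `Im (1 - z) > 0`. -/
def IsPrincipalHypergeometric (a b c : ℂ) (F : ℂ → ℂ) : Prop :=
  (∀ z : ℂ, ‖z‖ < 1 → F z = ordinaryHypergeometric a b c z) ∧
  DifferentiableOn ℂ F {z : ℂ | 1 - z ∈ slitPlane} ∧
  ∀ x : ℝ, 1 < x → Tendsto F (𝓝[{z : ℂ | 0 < (1 - z).im}] (x : ℂ)) (𝓝 (F x))

open scoped Classical in
/-- The principal value of `₂F₁(a, b; c; z)`, for `z ≠ 1`. -/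
def hypergeometricPV (a b c z : ℂ) : ℂ :=
  if h : ∃ F : ℂ → ℂ, IsPrincipalHypergeometric a b c F then h.choose z else 0

/-- `e(z) = exp(2πiz)`. -/
def expTwoPiI (z : ℂ) : ℂ := Complex.exp (2 * Real.pi * I * z)

/-- The beta function `Γ(u)Γ(v)/Γ(u+v)`. -/
def betaFn (u v : ℂ) : ℂ := Complex.Gamma u * Complex.Gamma v / Complex.Gamma (u + v)

/-- For a pair `η = (η₁, η₂)` of reals, the subgroup `Γ_η` of `Γ = SL₂(ℤ)` of all elements fixing
both `η₁` and `η₂` under the action on `ℝ ∪ {∞}` by linear fractional transformations. -/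
def pairStabilizer (η : ℝ × ℝ) : Subgroup SL(2, ℤ) :=
  (MulAction.stabilizer (GL (Fin 2) ℝ) (η.1 : OnePoint ℝ) ⊓
    MulAction.stabilizer (GL (Fin 2) ℝ) (η.2 : OnePoint ℝ)).comap
      (Matrix.SpecialLinearGroup.mapGL ℝ)

/-- The scaling matrix of a pair of reals `η₁ < η₂`; it maps `0` to `η₁` and `∞` to `η₂`. -/
def scalingMatrix (η : ℝ × ℝ) : Matrix (Fin 2) (Fin 2) ℝ :=
  (1 / Real.sqrt (η.2 - η.1)) • !![η.2, η.1; 1, 1]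

/-- The matrix `σ_η⁻¹ γ σ_η'`, for `γ ∈ SL₂(ℤ)`. -/
def scaledMatrix (η η' : ℝ × ℝ) (γ : SL(2, ℤ)) : Matrix (Fin 2) (Fin 2) ℝ :=
  (scalingMatrix η)⁻¹ * (γ : Matrix (Fin 2) (Fin 2) ℤ).map (fun t : ℤ => (t : ℝ)) *
    scalingMatrix η'

/-- The set `C_{ηη'}` of all products `ad`, where `(a, b; c, d)` runs over the elements of
`σ_η⁻¹ Γ σ_η'` with `abcd ≠ 0`. -/
def hypModuli (η η' : ℝ × ℝ) : Set ℝ :=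
  {C | ∃ γ : SL(2, ℤ),
    scaledMatrix η η' γ 0 0 * scaledMatrix η η' γ 0 1 *
      scaledMatrix η η' γ 1 0 * scaledMatrix η η' γ 1 1 ≠ 0 ∧
    scaledMatrix η η' γ 0 0 * scaledMatrix η η' γ 1 1 = C}

/-- The double coset space `Γ_η \ Γ / Γ_η'`. -/
abbrev HypDoubleCoset (η η' : ℝ × ℝ) : Type :=
  DoubleCoset.Quotient (pairStabilizer η : Set SL(2, ℤ)) (pairStabilizer η' : Set SL(2, ℤ))

/-- The double cosets with `ad = C` and `sgn(ac) = α`, where `(a, b; c, d) = σ_η⁻¹ γ σ_η'` for a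
representative `γ`; the two conditions do not depend on the representative. -/
def hypCosets (η η' : ℝ × ℝ) (C : ℝ) (α : SignType) : Set (HypDoubleCoset η η') :=
  {q | scaledMatrix η η' q.out 0 0 * scaledMatrix η η' q.out 1 1 = C ∧
    SignType.sign (scaledMatrix η η' q.out 0 0 * scaledMatrix η η' q.out 1 0) = α}

/-- The Kloosterman sum `S*_{ηη'}(m, n; C, α)`; here `l` and `l'` stand for `ℓ_η` and `ℓ_η'`. -/
def hypKloosterman (η η' : ℝ × ℝ) (l l' : ℝ) (m n : ℤ) (C : ℝ) (α : SignType) : ℂ :=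
  ∑ᶠ q ∈ hypCosets η η' C α,
    expTwoPiI (m / l * Complex.log
        ((scaledMatrix η η' q.out 0 0 / scaledMatrix η η' q.out 1 0 : ℝ) : ℂ) +
      n / l' * Complex.log
        ((-(scaledMatrix η η' q.out 1 0 / scaledMatrix η η' q.out 1 1) : ℝ) : ℂ))

/-- The term of the first sum belonging to `C ∈ C_{ηη'}`, `C ∉ (0, 1)` (for even `k`). -/
def hypTerm₁ (η η' : ℝ × ℝ) (l l' : ℝ) (k : ℕ) (m n : ℤ) (C : ℝ) : ℂ :=
  hypergeometricPV (k / 2 - 2 * Real.pi * I * m / l) (k / 2 + 2 * Real.pi * I * n / l') k (1 / C) *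
    ((hypKloosterman η η' l l' m n C 1 + hypKloosterman η η' l l' m n C (-1)) /
      (C : ℂ) ^ (k / 2))

/-- The term of the second sum belonging to `C ∈ C_{ηη'} ∩ (0, 1)` (for even `k`). -/
def hypTerm₂ (η η' : ℝ × ℝ) (l l' : ℝ) (k : ℕ) (m n : ℤ) (C : ℝ) : ℂ :=
  hypergeometricPV (k / 2 - 2 * Real.pi * I * m / l) (k / 2 + 2 * Real.pi * I * n / l') k (1 / C) *
    (hypKloosterman η η' l l' m n C 1 / (C : ℂ) ^ (k / 2))

/-- The term of the third sum belonging to `C ∈ C_{ηη'} ∩ (0, 1)` (for even `k`). -/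
def hypTerm₃ (η η' : ℝ × ℝ) (l l' : ℝ) (k : ℕ) (m n : ℤ) (C : ℝ) : ℂ :=
  ((C : ℂ) / (C - 1)) ^ (2 * Real.pi * I * n / l') *
    hypergeometricPV (k / 2 + 2 * Real.pi * I * m / l) (k / 2 + 2 * Real.pi * I * n / l') k
      (-1 / (C - 1)) *
    (hypKloosterman η η' l l' m n C (-1) / ((C : ℂ) - 1) ^ (k / 2))

/-- The prefactor times `Σ₁ + Σ₂ + Σ₃`: the `n`th coefficient in the hyperbolic expansion at `η'` of
the weight `k` hyperbolic Poincaré series `P_{η,m}`, without its diagonal terms. -/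
def hypCoeffSum (η η' : ℝ × ℝ) (l l' : ℝ) (k : ℕ) (m n : ℤ) : ℂ :=
  Complex.exp (2 * Real.pi ^ 2 * n / l') / l' *
    betaFn (k / 2 - 2 * Real.pi * I * n / l') (k / 2 + 2 * Real.pi * I * n / l') *
    ((∑' C : {C : ℝ // C ∈ hypModuli η η' ∧ C ∉ Set.Ioo 0 1}, hypTerm₁ η η' l l' k m n C) +
      (∑' C : {C : ℝ // C ∈ hypModuli η η' ∧ C ∈ Set.Ioo 0 1}, hypTerm₂ η η' l l' k m n C) +
      (∑' C : {C : ℝ // C ∈ hypModuli η η' ∧ C ∈ Set.Ioo 0 1}, hypTerm₃ η η' l l' k m n C))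

open scoped Classical in
/-- `ε_D = a₀ + c₀ √D`, for the positive integer solution `(a₀, c₀)` of `a² - D c² = 1` with `a₀ > 1`
minimal; it exists (and is unique) whenever `D` is not a square. -/
def pellUnit (D : ℕ) : ℝ :=
  if h : ∃ s : Pell.Solution₁ (D : ℤ), Pell.IsFundamental s then
    h.choose.x + h.choose.y * Real.sqrt D
  else 1

/-- The pair `(-√D, √D)`. -/
def sqrtPair (D : ℕ) : ℝ × ℝ := (-Real.sqrt D, Real.sqrt D)

/-- The length `ℓ_η = 2 log ε_D` for `η = (-√D, √D)`. -/
def sqrtPairLength (D : ℕ) : ℝ := 2 * Real.log (pellUnit D)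

/-- `Φ(D)`: the coefficient sum for `η = η' = (-√D, √D)`, `m = n = 0` and `k = 10`. -/
def Phi (D : ℕ) : ℂ :=
  hypCoeffSum (sqrtPair D) (sqrtPair D) (sqrtPairLength D) (sqrtPairLength D) 10 0 0

end

/-!
Write `η = (-√D, √D)`, `L = ℓ_η`, and let `a, b, c, d` be the entries of `σ_η⁻¹ γ σ_η`.

The Poincaré series `∑ Q(z, 1)⁻⁵` over the binary quadratic forms `Q` equivalent to `x² - Dy²`,
that is, over `x ∈ Γ / Γ_η`, is a cusp form of weight 10 and level one, and there are none besides
zero (`poincareSeries_eq_zero`). On the geodesic `z = σ_η(i eˢ)` from `-√D` to `√D` this says,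
after division by a common factor, that `∑ K_γ(s)⁻⁵ = 0` over `γ ∈ Γ_η \ Γ`, where
`K_γ(s) = (ad + bc) + i (ac eˢ - bd e⁻ˢ)` (`tsum_cycleKernel`). This
identity is integrated over a period `0 ≤ s ≤ L` and unfolded.

* The trivial coset has `K = 1` and contributes `L`.
* If `b` or `c` vanishes, then the coset is trivial; if `a` or `d` vanishes, then `γ` interchanges
  `-√D` and `√D` (`not_isGeneric_iff`). Such `γ` exist if and only if `x² - Dy² = -1` is solvable
  (`exists_isSwap_iff`); they form one coset, which has `K = -1` and contributes `-L`.
* A double coset with `abcd ≠ 0` is the disjoint union of the cosets `Γ_η γ δⁿ`, where `δ` generates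
  `Γ_η` up to sign and acts on the geodesic as the translation by `L`. Its cosets together
  contribute the integral of `K_γ(s)⁻⁵` over the whole line (`cycleIntegral`).

So the cycle integrals of the double cosets with `abcd ≠ 0` add up to `0` if the negative Pell
equation is solvable and to `-L` if not (`hasSum_cycleIntegral`). They are also the terms of `Φ(D)`:
up to the factor `B(5, 5) = 1 / 630`, the hypergeometric terms are Euler integrals
`∫ (u / ((1 + u)(v + u)))⁵ du / u` over `0 < u < ∞`, with `1 - v = 1 / C` or `1 - v = -1 / (C - 1)`.
Rotating the path to the positive imaginary axis (`integral_eulerKernel_eq_rotatedIntegral`) turns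
them into the cycle integrals, and also exhibits the boundary values of the hypergeometric function
on its cut; this settles the existence of the principal branch, so that `hypergeometricPV` has its
intended value (`isPrincipalHypergeometric_principalHypergeometric`). Hence `Φ(D)` is `1 / L` times
the sum of the cycle integrals.

Only finitely many double cosets have bounded `ad` (`finite_isGeneric_abs_le`), because the
Poincaré series converges absolutely and a bound on `ad` bounds one of the terms that belong to the
double coset from below.
-/

open Complex Filter Topology MatrixGroups MeasureTheory
open scoped ModularForm

noncomputable section

variable {D : ℕ}

/-! ### The matrices `σ_η⁻¹ γ σ_η` -/

/-- The matrix `σ_η⁻¹ γ σ_η` for `η = (-√D, √D)`. -/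
abbrev sqrtScaled (D : ℕ) (γ : SL(2, ℤ)) : Matrix (Fin 2) (Fin 2) ℝ :=
  scaledMatrix (sqrtPair D) (sqrtPair D) γ

/-- The group `Γ_η` for `η = (-√D, √D)`. -/
abbrev sqrtStabilizer (D : ℕ) : Subgroup SL(2, ℤ) := pairStabilizer (sqrtPair D)

/-- `γ` has `abcd ≠ 0`, where `(a, b; c, d) = σ_η⁻¹ γ σ_η`. -/
def IsGeneric (D : ℕ) (γ : SL(2, ℤ)) : Prop :=
  sqrtScaled D γ 0 0 * sqrtScaled D γ 0 1 * sqrtScaled D γ 1 0 * sqrtScaled D γ 1 1 ≠ 0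

lemma SL2_det_eq (γ : SL(2, ℤ)) : γ 0 0 * γ 1 1 - γ 0 1 * γ 1 0 = 1 := by
  rw [← Matrix.det_fin_two, γ.det_coe]

lemma pos_of_not_isSquare (hD : ¬ IsSquare D) : 0 < D :=
  Nat.pos_of_ne_zero fun h => hD (h ▸ ⟨0, rfl⟩)

lemma sqrt_natCast_pos (hD : ¬ IsSquare D) : 0 < √(D : ℝ) :=
  Real.sqrt_pos.2 (Nat.cast_pos.2 (pos_of_not_isSquare hD))

lemma sq_sqrt_natCast (D : ℕ) : √(D : ℝ) ^ 2 = D := Real.sq_sqrt (Nat.cast_nonneg D)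

lemma int_sqrt_independent (hD : ¬ IsSquare D) {x y : ℤ} (h : x * √(D : ℝ) + y = 0) :
    x = 0 ∧ y = 0 := by
  have hirr : Irrational √(D : ℝ) := irrational_sqrt_natCast_iff.2 hD
  by_cases hx : x = 0
  · subst hx
    simpa using h
  · exact absurd h ((hirr.intCast_mul hx).add_intCast y).ne_zero

lemma scalingMatrix_sqrtPair (D : ℕ) : scalingMatrix (sqrtPair D) =
    (1 / √(2 * √(D : ℝ))) • !![√(D : ℝ), -√(D : ℝ); 1, 1] := by
  simp only [scalingMatrix, sqrtPair]
  congr 3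
  ring

lemma scalingMatrix_sqrtPair_inv (hD : ¬ IsSquare D) : (scalingMatrix (sqrtPair D))⁻¹ =
    (1 / √(2 * √(D : ℝ))) • !![1, √(D : ℝ); -1, √(D : ℝ)] := by
  have hr := sqrt_natCast_pos hD
  apply Matrix.inv_eq_left_inv
  have h : (1 / √(2 * √(D : ℝ))) * (1 / √(2 * √(D : ℝ))) * (2 * √(D : ℝ)) = 1 := by
    rw [div_mul_div_comm, Real.mul_self_sqrt (by positivity)]
    field_simp
  rw [scalingMatrix_sqrtPair, Matrix.smul_mul, Matrix.mul_smul, smul_smul]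
  generalize 1 / √(2 * √(D : ℝ)) * (1 / √(2 * √(D : ℝ))) = k at h
  generalize √(D : ℝ) = r at *
  ext i j
  fin_cases i <;> fin_cases j <;> simp <;> linear_combination h

lemma sqrtScaled_eq (hD : ¬ IsSquare D) (γ : SL(2, ℤ)) : sqrtScaled D γ =
    (1 / (2 * √(D : ℝ))) •
      !![(γ 0 0 + γ 1 1) * √(D : ℝ) + (γ 0 1 + D * γ 1 0),
          (γ 1 1 - γ 0 0) * √(D : ℝ) + (γ 0 1 - D * γ 1 0);
          (γ 1 1 - γ 0 0) * √(D : ℝ) - (γ 0 1 - D * γ 1 0),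
          (γ 0 0 + γ 1 1) * √(D : ℝ) - (γ 0 1 + D * γ 1 0)] := by
  have hr := sqrt_natCast_pos hD
  have h : (1 / √(2 * √(D : ℝ))) * (1 / √(2 * √(D : ℝ))) = 1 / (2 * √(D : ℝ)) := by
    rw [div_mul_div_comm, Real.mul_self_sqrt (by positivity), one_mul]
  rw [sqrtScaled, scaledMatrix, scalingMatrix_sqrtPair_inv hD, scalingMatrix_sqrtPair,
    Matrix.smul_mul, Matrix.smul_mul, Matrix.mul_smul, smul_smul, h]
  congr 1
  have h2 := sq_sqrt_natCast D
  generalize √(D : ℝ) = r at *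
  rw [Matrix.eta_fin_two ((γ : Matrix (Fin 2) (Fin 2) ℤ).map fun t : ℤ => (t : ℝ))]
  ext i j
  fin_cases i <;> fin_cases j <;> simp [Matrix.mul_apply, Fin.sum_univ_two] <;> rw [← h2] <;> ring

lemma sqrtScaled_mul (hD : ¬ IsSquare D) (γ δ : SL(2, ℤ)) :
    sqrtScaled D (γ * δ) = sqrtScaled D γ * sqrtScaled D δ := by
  have hr := sqrt_natCast_pos hD
  have h2 := sq_sqrt_natCast D
  rw [sqrtScaled_eq hD, sqrtScaled_eq hD, sqrtScaled_eq hD, Matrix.smul_mul, Matrix.mul_smul,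
    smul_smul]
  generalize √(D : ℝ) = r at *
  ext i j
  fin_cases i <;> fin_cases j <;> simp [Matrix.mul_apply, Fin.sum_univ_two] <;> field_simp <;>
    rw [← h2] <;> ring

lemma sqrtScaled_one (hD : ¬ IsSquare D) : sqrtScaled D 1 = 1 := by
  have hr := sqrt_natCast_pos hD
  rw [sqrtScaled_eq hD]
  ext i j
  fin_cases i <;> fin_cases j <;> simp <;> field_simp <;> ring

lemma sqrtScaled_det (hD : ¬ IsSquare D) (γ : SL(2, ℤ)) :
    sqrtScaled D γ 0 0 * sqrtScaled D γ 1 1 - sqrtScaled D γ 0 1 * sqrtScaled D γ 1 0 = 1 := by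
  have hr := sqrt_natCast_pos hD
  have h2 := sq_sqrt_natCast D
  have hd : (γ 0 0 : ℝ) * γ 1 1 - γ 0 1 * γ 1 0 = 1 := mod_cast SL2_det_eq γ
  rw [sqrtScaled_eq hD]
  generalize √(D : ℝ) = r at *
  simp
  field_simp
  rw [← h2]
  linear_combination (4 * r ^ 2) * hd

lemma mapGL_smul_coe_eq_self_iff (γ : SL(2, ℤ)) (x : ℝ) :
    Matrix.SpecialLinearGroup.mapGL ℝ γ • (x : OnePoint ℝ) = x ↔
      γ 0 0 * x + γ 0 1 = x * (γ 1 0 * x + γ 1 1) := by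
  have hd : (γ 0 0 : ℝ) * γ 1 1 - γ 0 1 * γ 1 0 = 1 := mod_cast SL2_det_eq γ
  rw [OnePoint.smul_some_eq_ite]
  simp only [Matrix.SpecialLinearGroup.mapGL_coe_matrix, Matrix.SpecialLinearGroup.map_apply_coe,
    RingHom.mapMatrix_apply, Matrix.map_apply, algebraMap_int_eq, eq_intCast]
  split_ifs with h
  · refine ⟨fun h' => absurd h' (OnePoint.infty_ne_coe x), fun h' => ?_⟩
    rw [h, mul_zero] at h'
    exfalso
    have : (γ 0 0 : ℝ) * (γ 1 0 * x + γ 1 1) - γ 1 0 * (γ 0 0 * x + γ 0 1) = 1 := by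
      linear_combination hd
    rw [h, h'] at this
    simp at this
  · rw [OnePoint.coe_eq_coe, div_eq_iff h]

lemma mem_sqrtStabilizer_iff (hD : ¬ IsSquare D) (γ : SL(2, ℤ)) :
    γ ∈ sqrtStabilizer D ↔ γ 0 0 = γ 1 1 ∧ γ 0 1 = D * γ 1 0 := by
  have hr := sqrt_natCast_pos hD
  have h2 := sq_sqrt_natCast D
  simp only [sqrtStabilizer, pairStabilizer, sqrtPair, Subgroup.mem_comap, Subgroup.mem_inf,
    MulAction.mem_stabilizer_iff, mapGL_smul_coe_eq_self_iff]
  constructor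
  · rintro ⟨-, h⟩
    have h' : ((γ 0 0 - γ 1 1 : ℤ) : ℝ) * √(D : ℝ) + ((γ 0 1 - D * γ 1 0 : ℤ) : ℝ) = 0 := by
      push_cast
      linear_combination h + (γ 1 0 : ℝ) * h2
    obtain ⟨h3, h4⟩ := int_sqrt_independent hD h'
    exact ⟨by lia, by lia⟩
  · rintro ⟨h3, h4⟩
    rw [h3, h4]
    push_cast
    constructor <;> linear_combination (-γ 1 0 : ℝ) * h2

lemma sqrtScaled_of_mem (hD : ¬ IsSquare D) {γ : SL(2, ℤ)} (hγ : γ ∈ sqrtStabilizer D) :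
    sqrtScaled D γ 0 0 = γ 0 0 + γ 1 0 * √(D : ℝ) ∧ sqrtScaled D γ 1 1 = γ 0 0 - γ 1 0 * √(D : ℝ) ∧
      sqrtScaled D γ 0 1 = 0 ∧ sqrtScaled D γ 1 0 = 0 := by
  have hr := sqrt_natCast_pos hD
  have h2 := sq_sqrt_natCast D
  obtain ⟨h3, h4⟩ := (mem_sqrtStabilizer_iff hD γ).1 hγ
  rw [sqrtScaled_eq hD, ← h3, h4]
  generalize √(D : ℝ) = r at *
  simp
  field_simp
  rw [← h2]
  constructor <;> ring

lemma mem_sqrtStabilizer_of_sqrtScaled (hD : ¬ IsSquare D) {γ : SL(2, ℤ)}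
    (h : sqrtScaled D γ 0 1 = 0 ∨ sqrtScaled D γ 1 0 = 0) : γ ∈ sqrtStabilizer D := by
  have hr := sqrt_natCast_pos hD
  rw [mem_sqrtStabilizer_iff hD]
  rw [sqrtScaled_eq hD] at h
  simp [hr.ne'] at h
  rcases h with h | h
  · have h' : ((γ 1 1 - γ 0 0 : ℤ) : ℝ) * √(D : ℝ) + ((γ 0 1 - D * γ 1 0 : ℤ) : ℝ) = 0 := by
      push_cast; linear_combination h
    obtain ⟨h3, h4⟩ := int_sqrt_independent hD h'
    exact ⟨by lia, by lia⟩
  · have h' : ((γ 1 1 - γ 0 0 : ℤ) : ℝ) * √(D : ℝ) + ((D * γ 1 0 - γ 0 1 : ℤ) : ℝ) = 0 := by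
      push_cast; linear_combination h
    obtain ⟨h3, h4⟩ := int_sqrt_independent hD h'
    exact ⟨by lia, by lia⟩

/-- `γ` interchanges `-√D` and `√D`. -/
def IsSwap (D : ℕ) (γ : SL(2, ℤ)) : Prop := γ 1 1 = -γ 0 0 ∧ γ 0 1 = -(D * γ 1 0)

lemma isSwap_of_sqrtScaled (hD : ¬ IsSquare D) {γ : SL(2, ℤ)}
    (h : sqrtScaled D γ 0 0 = 0 ∨ sqrtScaled D γ 1 1 = 0) : IsSwap D γ := by
  have hr := sqrt_natCast_pos hD
  rw [sqrtScaled_eq hD] at h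
  simp [hr.ne'] at h
  rcases h with h | h
  · have h' : ((γ 0 0 + γ 1 1 : ℤ) : ℝ) * √(D : ℝ) + ((γ 0 1 + D * γ 1 0 : ℤ) : ℝ) = 0 := by
      push_cast; linear_combination h
    obtain ⟨h3, h4⟩ := int_sqrt_independent hD h'
    exact ⟨by lia, by lia⟩
  · have h' : ((γ 0 0 + γ 1 1 : ℤ) : ℝ) * √(D : ℝ) + ((-(D * γ 1 0) - γ 0 1 : ℤ) : ℝ) = 0 := by
      push_cast; linear_combination h
    obtain ⟨h3, h4⟩ := int_sqrt_independent hD h'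
    exact ⟨by lia, by lia⟩

lemma IsSwap.sqrtScaled (hD : ¬ IsSquare D) {γ : SL(2, ℤ)} (h : IsSwap D γ) :
    sqrtScaled D γ 0 0 = 0 ∧ sqrtScaled D γ 1 1 = 0 := by
  obtain ⟨h3, h4⟩ := h
  rw [sqrtScaled_eq hD, h3, h4]
  simp

lemma IsSwap.not_mem (hD : ¬ IsSquare D) {γ : SL(2, ℤ)} (h : IsSwap D γ) :
    γ ∉ sqrtStabilizer D := by
  intro hm
  obtain ⟨h1, h2⟩ := h.sqrtScaled hD
  obtain ⟨-, -, h3, h4⟩ := sqrtScaled_of_mem hD hm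
  have := sqrtScaled_det hD γ
  simp [h1, h3] at this

/-- If one of `a, b, c, d` vanishes, then so do `b, c` or `a, d`, since conjugation in `ℚ(√D)`
interchanges the entries of `σ_η⁻¹ γ σ_η` crosswise. -/
lemma not_isGeneric_iff (hD : ¬ IsSquare D) {γ : SL(2, ℤ)} :
    ¬ IsGeneric D γ ↔ γ ∈ sqrtStabilizer D ∨ IsSwap D γ := by
  rw [IsGeneric, not_not, mul_eq_zero, mul_eq_zero, mul_eq_zero]
  constructor
  · rintro (((h | h) | h) | h)
    · exact Or.inr (isSwap_of_sqrtScaled hD (Or.inl h))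
    · exact Or.inl (mem_sqrtStabilizer_of_sqrtScaled hD (Or.inl h))
    · exact Or.inl (mem_sqrtStabilizer_of_sqrtScaled hD (Or.inr h))
    · exact Or.inr (isSwap_of_sqrtScaled hD (Or.inr h))
  · rintro (h | h)
    · exact Or.inl (Or.inr (sqrtScaled_of_mem hD h).2.2.2)
    · exact Or.inr (h.sqrtScaled hD).2

lemma exists_isSwap_iff (D : ℕ) :
    (∃ γ : SL(2, ℤ), IsSwap D γ) ↔ ∃ x y : ℤ, x ^ 2 - D * y ^ 2 = -1 := by
  constructor
  · rintro ⟨γ, h3, h4⟩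
    refine ⟨γ 0 0, γ 1 0, ?_⟩
    have := SL2_det_eq γ
    rw [h3, h4] at this
    linear_combination -this
  · rintro ⟨x, y, h⟩
    refine ⟨⟨!![x, -(D * y); y, -x], ?_⟩, ?_⟩
    · rw [Matrix.det_fin_two]
      simp
      linear_combination -h
    · simp [IsSwap]

lemma IsSwap.mul_mem (hD : ¬ IsSquare D) {γ δ : SL(2, ℤ)} (hγ : IsSwap D γ)
    (hδ : IsSwap D δ) : γ * δ ∈ sqrtStabilizer D := by
  apply mem_sqrtStabilizer_of_sqrtScaled hD
  left
  rw [sqrtScaled_mul hD, Matrix.mul_apply, Fin.sum_univ_two, (hγ.sqrtScaled hD).1,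
    (hδ.sqrtScaled hD).2]
  simp

lemma IsSwap.inv {γ : SL(2, ℤ)} (hγ : IsSwap D γ) : IsSwap D γ⁻¹ := by
  obtain ⟨h3, h4⟩ := hγ
  simp [IsSwap, Matrix.SpecialLinearGroup.SL2_inv_expl, h3, h4]

/-! ### The stabilizer and Pell's equation -/

lemma exists_isFundamental (hD : ¬ IsSquare D) :
    ∃ s : Pell.Solution₁ (D : ℤ), Pell.IsFundamental s := by
  apply Pell.IsFundamental.exists_of_not_isSquare
  · exact_mod_cast pos_of_not_isSquare hD
  · rwa [Int.isSquare_natCast_iff]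

/-- The element of `SL₂(ℤ)` with which multiplication by `x + y√D` acts. -/
def pellMatrix (s : Pell.Solution₁ (D : ℤ)) : SL(2, ℤ) :=
  ⟨!![s.x, D * s.y; s.y, s.x], by rw [Matrix.det_fin_two]; simp; linear_combination s.prop⟩

lemma pellMatrix_mul (s t : Pell.Solution₁ (D : ℤ)) :
    pellMatrix (s * t) = pellMatrix s * pellMatrix t := by
  apply Subtype.ext
  rw [Matrix.SpecialLinearGroup.coe_mul]
  ext i j
  fin_cases i <;> fin_cases j <;>
    simp [pellMatrix, Matrix.mul_apply, Fin.sum_univ_two, Pell.Solution₁.x_mul,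
      Pell.Solution₁.y_mul] <;> ring

/-- `pellMatrix` as a homomorphism. -/
def pellHom (D : ℕ) : Pell.Solution₁ (D : ℤ) →* SL(2, ℤ) :=
  MonoidHom.mk' pellMatrix pellMatrix_mul

lemma pellMatrix_mem (hD : ¬ IsSquare D) (s : Pell.Solution₁ (D : ℤ)) :
    pellMatrix s ∈ sqrtStabilizer D := by
  rw [mem_sqrtStabilizer_iff hD]
  simp [pellMatrix]

lemma exists_pellMatrix_eq (hD : ¬ IsSquare D) {γ : SL(2, ℤ)} (hγ : γ ∈ sqrtStabilizer D) :
    ∃ s : Pell.Solution₁ (D : ℤ), pellMatrix s = γ := by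
  obtain ⟨h3, h4⟩ := (mem_sqrtStabilizer_iff hD γ).1 hγ
  refine ⟨Pell.Solution₁.mk (γ 0 0) (γ 1 0) ?_, ?_⟩
  · have := SL2_det_eq γ
    rw [← h3, h4] at this
    linear_combination this
  · ext i j
    fin_cases i <;> fin_cases j <;> simp [pellMatrix, h3, h4]

lemma pellMatrix_neg (s : Pell.Solution₁ (D : ℤ)) : pellMatrix (-s) = -pellMatrix s := by
  apply Subtype.ext
  rw [Matrix.SpecialLinearGroup.coe_neg]
  ext i j
  fin_cases i <;> fin_cases j <;> simp [pellMatrix]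

lemma one_lt_pellUnit (hD : ¬ IsSquare D) : 1 < pellUnit D := by
  have h := exists_isFundamental hD
  rw [pellUnit, dif_pos h]
  have h1 := h.choose_spec.1
  have h2 := h.choose_spec.2.1
  have : (1 : ℝ) < h.choose.x := by exact_mod_cast h1
  have : (0 : ℝ) < h.choose.y := by exact_mod_cast h2
  have := sqrt_natCast_pos hD
  nlinarith [mul_pos ‹(0 : ℝ) < h.choose.y› this]

lemma sqrtPairLength_pos (hD : ¬ IsSquare D) : 0 < sqrtPairLength D := by
  have := Real.log_pos (one_lt_pellUnit hD)
  rw [sqrtPairLength]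
  linarith

/-- Up to sign, `Γ_η` is infinite cyclic; its generator is conjugate to `diag(ε_D, ε_D⁻¹)`. -/
lemma exists_generator (hD : ¬ IsSquare D) : ∃ δ ∈ sqrtStabilizer D,
    (∀ n : ℤ, sqrtScaled D (δ ^ n) 0 0 = Real.exp (n * (sqrtPairLength D / 2)) ∧
      sqrtScaled D (δ ^ n) 1 1 = Real.exp (-(n * (sqrtPairLength D / 2)))) ∧
    ∀ γ ∈ sqrtStabilizer D, ∃ n : ℤ, γ = δ ^ n ∨ γ = -δ ^ n := by
  have h := exists_isFundamental hD
  have hu : pellUnit D = h.choose.x + h.choose.y * √(D : ℝ) := by rw [pellUnit, dif_pos h]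
  have h2 := sq_sqrt_natCast D
  set s := h.choose with hs
  have hf : Pell.IsFundamental s := h.choose_spec
  have hmem := pellMatrix_mem hD s
  obtain ⟨e1, e2, e3, e4⟩ := sqrtScaled_of_mem hD hmem
  have e0 : pellUnit D = Real.exp (sqrtPairLength D / 2) := by
    rw [sqrtPairLength, mul_div_cancel_left₀ _ two_ne_zero,
      Real.exp_log (one_pos.trans (one_lt_pellUnit hD))]
  have e1' : sqrtScaled D (pellMatrix s) 0 0 = Real.exp (sqrtPairLength D / 2) := by
    rw [e1, ← e0, hu]
    simp [pellMatrix]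
  have diag : ∀ γ ∈ sqrtStabilizer D, ∀ γ' ∈ sqrtStabilizer D,
      sqrtScaled D (γ * γ') 0 0 = sqrtScaled D γ 0 0 * sqrtScaled D γ' 0 0 := by
    intro γ hγ γ' hγ'
    rw [sqrtScaled_mul hD, Matrix.mul_apply, Fin.sum_univ_two, (sqrtScaled_of_mem hD hγ).2.2.1]
    simp
  have det : ∀ γ ∈ sqrtStabilizer D, sqrtScaled D γ 0 0 * sqrtScaled D γ 1 1 = 1 := by
    intro γ hγ
    have := sqrtScaled_det hD γ
    rwa [(sqrtScaled_of_mem hD hγ).2.2.1, zero_mul, sub_zero] at this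
  have pow : ∀ n : ℤ, sqrtScaled D (pellMatrix s ^ n) 0 0 =
      Real.exp (n * (sqrtPairLength D / 2)) := by
    intro n
    induction n using Int.induction_on with
    | zero => simp [sqrtScaled_one hD]
    | succ n ih =>
      rw [zpow_add_one, diag _ (zpow_mem hmem _) _ hmem, ih, e1', ← Real.exp_add]
      push_cast
      ring_nf
    | pred n ih =>
      have h3 := diag _ (zpow_mem hmem (-(n : ℤ) - 1)) _ hmem
      rw [← zpow_add_one, sub_add_cancel, ih, e1'] at h3
      rw [eq_div_of_mul_eq (Real.exp_pos _).ne' h3.symm, ← Real.exp_sub]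
      push_cast
      ring_nf
  refine ⟨pellMatrix s, hmem, fun n => ⟨pow n, ?_⟩, fun γ hγ => ?_⟩
  · have := det _ (zpow_mem hmem n)
    rw [pow] at this
    rw [Real.exp_neg]
    exact eq_inv_of_mul_eq_one_right this
  · obtain ⟨t, rfl⟩ := exists_pellMatrix_eq hD hγ
    obtain ⟨n, hn⟩ := hf.eq_zpow_or_neg_zpow t
    have key : pellMatrix (s ^ n) = pellMatrix s ^ n := map_zpow (pellHom D) s n
    refine ⟨n, hn.imp ?_ ?_⟩
    · rintro rfl
      exact key
    · rintro rfl
      rw [pellMatrix_neg, key]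

/-! ### Binary quadratic forms equivalent to `x² - Dy²` -/

/-- The value at `(z, 1)` of the binary quadratic form `(x² - Dy²) ∘ γ`. -/
def pellForm (D : ℕ) (γ : SL(2, ℤ)) (z : ℂ) : ℂ :=
  (γ 0 0 * z + γ 0 1) ^ 2 - D * (γ 1 0 * z + γ 1 1) ^ 2

/-- The coefficient of `x²` in `(x² - Dy²) ∘ γ`. -/
def pellCoeffA (D : ℕ) (γ : SL(2, ℤ)) : ℤ := γ 0 0 ^ 2 - D * γ 1 0 ^ 2

/-- The coefficient of `xy` in `(x² - Dy²) ∘ γ`. -/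
def pellCoeffB (D : ℕ) (γ : SL(2, ℤ)) : ℤ := 2 * (γ 0 0 * γ 0 1 - D * γ 1 0 * γ 1 1)

/-- The coefficient of `y²` in `(x² - Dy²) ∘ γ`. -/
def pellCoeffC (D : ℕ) (γ : SL(2, ℤ)) : ℤ := γ 0 1 ^ 2 - D * γ 1 1 ^ 2

lemma pellForm_eq (γ : SL(2, ℤ)) (z : ℂ) :
    pellForm D γ z = pellCoeffA D γ * z ^ 2 + pellCoeffB D γ * z + pellCoeffC D γ := by
  simp only [pellForm, pellCoeffA, pellCoeffB, pellCoeffC]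
  push_cast
  ring

lemma pellCoeff_discrim (γ : SL(2, ℤ)) :
    pellCoeffB D γ ^ 2 - 4 * pellCoeffA D γ * pellCoeffC D γ = 4 * D := by
  have h := SL2_det_eq γ
  simp only [pellCoeffA, pellCoeffB, pellCoeffC]
  linear_combination (4 * D * (γ 0 0 * γ 1 1 - γ 0 1 * γ 1 0 + 1)) * h

lemma pellCoeffA_ne_zero (hD : ¬ IsSquare D) (γ : SL(2, ℤ)) : pellCoeffA D γ ≠ 0 := by
  intro h
  have h2 := sq_sqrt_natCast D
  have h1 : ((1 : ℤ) * √(D : ℝ) * γ 1 0 - γ 0 0) * ((1 : ℤ) * √(D : ℝ) * γ 1 0 + γ 0 0) = 0 := by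
    have : ((γ 0 0 : ℝ) ^ 2 - D * γ 1 0 ^ 2) = 0 := mod_cast h
    push_cast
    linear_combination (γ 1 0 : ℝ) ^ 2 * h2 - this
  have h3 : γ 1 0 = 0 ∧ γ 0 0 = 0 := by
    rcases mul_eq_zero.1 h1 with h1 | h1
    · obtain ⟨h4, h5⟩ := int_sqrt_independent hD (x := γ 1 0) (y := -γ 0 0)
        (by push_cast; push_cast at h1; linear_combination h1)
      exact ⟨h4, by lia⟩
    · exact int_sqrt_independent hD (by push_cast at h1; linear_combination h1)
  have := SL2_det_eq γ
  rw [h3.1, h3.2] at this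
  simp at this

lemma SL2_mul_apply (γ δ : SL(2, ℤ)) (i j : Fin 2) :
    (γ * δ) i j = γ i 0 * δ 0 j + γ i 1 * δ 1 j := by
  rw [Matrix.SpecialLinearGroup.coe_mul, Matrix.mul_apply, Fin.sum_univ_two]

lemma pellCoeff_mul (γ δ : SL(2, ℤ)) :
    pellCoeffA D (γ * δ) = pellCoeffA D γ * δ 0 0 ^ 2 + pellCoeffB D γ * (δ 0 0 * δ 1 0) +
      pellCoeffC D γ * δ 1 0 ^ 2 ∧
    pellCoeffB D (γ * δ) = 2 * pellCoeffA D γ * (δ 0 0 * δ 0 1) +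
      pellCoeffB D γ * (δ 0 0 * δ 1 1 + δ 0 1 * δ 1 0) + 2 * pellCoeffC D γ * (δ 1 0 * δ 1 1) ∧
    pellCoeffC D (γ * δ) = pellCoeffA D γ * δ 0 1 ^ 2 + pellCoeffB D γ * (δ 0 1 * δ 1 1) +
      pellCoeffC D γ * δ 1 1 ^ 2 := by
  simp only [pellCoeffA, pellCoeffB, pellCoeffC, SL2_mul_apply]
  refine ⟨?_, ?_, ?_⟩ <;> ring

lemma pellForm_mul_of_mem (hD : ¬ IsSquare D) {h : SL(2, ℤ)} (hh : h ∈ sqrtStabilizer D)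
    (γ : SL(2, ℤ)) : pellForm D (h * γ) = pellForm D γ := by
  obtain ⟨h3, h4⟩ := (mem_sqrtStabilizer_iff hD h).1 hh
  have hd := SL2_det_eq h
  rw [← h3, h4] at hd
  have hd' : (h 0 0 : ℂ) * h 0 0 - D * h 1 0 * h 1 0 = 1 := mod_cast hd
  ext z
  simp only [pellForm, SL2_mul_apply, ← h3, h4]
  push_cast
  linear_combination ((γ 0 0 * z + γ 0 1) ^ 2 - D * (γ 1 0 * z + γ 1 1) ^ 2) * hd'

/-- A form is determined by its first two coefficients, as its discriminant is `4D` and its first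
coefficient does not vanish; and `Γ_η` is the stabilizer of `x² - Dy²`. -/
lemma mul_inv_mem_of_pellCoeff_eq (hD : ¬ IsSquare D) {γ δ : SL(2, ℤ)}
    (hA : pellCoeffA D γ = pellCoeffA D δ) (hB : pellCoeffB D γ = pellCoeffB D δ) :
    γ * δ⁻¹ ∈ sqrtStabilizer D := by
  have hC : pellCoeffC D γ = pellCoeffC D δ := by
    have h1 := pellCoeff_discrim (D := D) γ
    have h2 := pellCoeff_discrim (D := D) δ
    rw [hA, hB] at h1
    have h3 := pellCoeffA_ne_zero hD δ
    have h4 : (4 * pellCoeffA D δ) * pellCoeffC D γ = (4 * pellCoeffA D δ) * pellCoeffC D δ := by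
      linear_combination h2 - h1
    exact mul_left_cancel₀ (by simpa using h3) h4
  obtain ⟨a1, b1, c1⟩ := pellCoeff_mul (D := D) γ δ⁻¹
  obtain ⟨a2, b2, c2⟩ := pellCoeff_mul (D := D) δ δ⁻¹
  rw [hA, hB, hC, ← a2, mul_inv_cancel] at a1
  rw [hA, hB, hC, ← b2, mul_inv_cancel] at b1
  rw [hA, hB, hC, ← c2, mul_inv_cancel] at c1
  rw [mem_sqrtStabilizer_iff hD]
  have hd := SL2_det_eq (γ * δ⁻¹)
  generalize γ * δ⁻¹ = g at *
  simp [pellCoeffA, pellCoeffB, pellCoeffC] at a1 b1 c1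
  have b2 : g 0 0 * g 0 1 - D * g 1 0 * g 1 1 = 0 := by linarith
  constructor
  · linear_combination (- g 0 0) * hd + g 1 1 * a1 - g 1 0 * b2
  · linear_combination (-g 0 1) * hd + g 1 1 * b2 - g 1 0 * c1

/-- The key estimate for the convergence of the Poincaré series: a form of positive discriminant is
bounded below by a linear form. -/
lemma im_mul_norm_le_of_discrim_pos {a b c : ℝ} (ha : a ≠ 0) (hd : 0 < b ^ 2 - 4 * a * c) {z : ℂ}
    (hz : 0 < z.im) : z.im * ‖2 * a * z + b‖ ≤ 2 * ‖a * z ^ 2 + b * z + c‖ := by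
  set s : ℝ := √(b ^ 2 - 4 * a * c) with hs
  have hs2 : (s : ℂ) ^ 2 = b ^ 2 - 4 * a * c := by
    rw [hs, ← Complex.ofReal_pow, Real.sq_sqrt hd.le]
    push_cast
    ring
  set w : ℂ := 2 * a * z + b with hw
  have hprod : ‖w - s‖ * ‖w + s‖ = 4 * |a| * ‖a * z ^ 2 + b * z + c‖ := by
    have h4 : (4 : ℝ) * |a| = ‖(4 * a : ℂ)‖ := by simp
    rw [h4, ← norm_mul, ← norm_mul]
    congr 1
    rw [hw]
    linear_combination -hs2
  have him : w.im = 2 * a * z.im := by simp [hw]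
  have h1 : 2 * |a| * z.im ≤ ‖w - s‖ := by
    have := Complex.abs_im_le_norm (w - s)
    rw [Complex.sub_im, Complex.ofReal_im, sub_zero, him, abs_mul, abs_mul, abs_two,
      abs_of_pos hz] at this
    exact this
  have h2 : 2 * |a| * z.im ≤ ‖w + s‖ := by
    have := Complex.abs_im_le_norm (w + s)
    rw [Complex.add_im, Complex.ofReal_im, add_zero, him, abs_mul, abs_mul, abs_two,
      abs_of_pos hz] at this
    exact this
  have h3 : 2 * ‖w‖ ≤ ‖w - s‖ + ‖w + s‖ := by
    have := norm_add_le (w - s) (w + s)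
    rw [show w - s + (w + s) = 2 * w by ring, norm_mul, Complex.norm_ofNat] at this
    exact this
  have ha' : 0 < |a| := abs_pos.2 ha
  have hp : 0 < 2 * |a| * z.im := by positivity
  -- the larger factor is at least `‖w‖`, the smaller one at least `2 |a| Im z`
  have h4 : 2 * |a| * z.im * ‖w‖ ≤ ‖w - s‖ * ‖w + s‖ := by
    rcases le_total ‖w - s‖ ‖w + s‖ with h | h
    · exact mul_le_mul h1 (by linarith) (norm_nonneg _) (norm_nonneg _)
    · rw [mul_comm ‖w - s‖]
      exact mul_le_mul h2 (by linarith) (norm_nonneg _) (norm_nonneg _)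
  rw [hprod] at h4
  have : 2 * |a| * (z.im * ‖w‖) ≤ 2 * |a| * (2 * ‖a * z ^ 2 + b * z + c‖) := by linarith
  exact le_of_mul_le_mul_left this (by positivity)

lemma im_mul_norm_le_pellForm (hD : ¬ IsSquare D) (γ : SL(2, ℤ)) {z : ℂ} (hz : 0 < z.im) :
    z.im * ‖((2 * pellCoeffA D γ : ℤ) : ℂ) * z + pellCoeffB D γ‖ ≤ 2 * ‖pellForm D γ z‖ := by
  have h := im_mul_norm_le_of_discrim_pos (a := pellCoeffA D γ) (b := pellCoeffB D γ)
    (c := pellCoeffC D γ) (by exact_mod_cast pellCoeffA_ne_zero hD γ)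
    (by
      have h1 := pellCoeff_discrim (D := D) γ
      have h2 := pos_of_not_isSquare hD
      have h3 : 0 < pellCoeffB D γ ^ 2 - 4 * pellCoeffA D γ * pellCoeffC D γ := by
        rw [h1]; positivity
      exact_mod_cast h3) hz
  rw [pellForm_eq]
  push_cast at h ⊢
  exact h

/-! ### The Poincaré series -/

/-- The left cosets `gΓ_η`, which correspond to the forms `(x² - Dy²) ∘ g⁻¹`. -/
abbrev SqrtCoset (D : ℕ) : Type := SL(2, ℤ) ⧸ sqrtStabilizer D

/-- The vector `(2A, B)`, for the form `Ax² + Bxy + Cy²` that belongs to a coset. -/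
def cosetVec (x : SqrtCoset D) : Fin 2 → ℤ :=
  ![2 * pellCoeffA D x.out⁻¹, pellCoeffB D x.out⁻¹]

lemma cosetVec_injective (hD : ¬ IsSquare D) : Function.Injective (cosetVec (D := D)) := by
  intro x y h
  have h0 := congrFun h 0
  have h1 := congrFun h 1
  simp [cosetVec] at h0 h1
  have := mul_inv_mem_of_pellCoeff_eq hD h0 h1
  rw [inv_inv] at this
  rw [← QuotientGroup.out_eq' x, ← QuotientGroup.out_eq' y]
  exact QuotientGroup.eq.2 this

lemma cosetVec_ne_zero (hD : ¬ IsSquare D) (x : SqrtCoset D) : cosetVec x ≠ 0 := by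
  intro h
  have h0 := congrFun h 0
  simp [cosetVec] at h0
  exact pellCoeffA_ne_zero hD _ h0

lemma summable_norm_cosetVec (hD : ¬ IsSquare D) :
    Summable fun x : SqrtCoset D => (‖cosetVec x‖ ^ 5)⁻¹ := by
  have h := (EisensteinSeries.summable_one_div_norm_rpow (k := 5) (by norm_num)).comp_injective
    (cosetVec_injective hD)
  refine h.congr fun x => ?_
  simp only [Function.comp]
  rw [Real.rpow_neg (norm_nonneg _)]
  norm_cast

/-- The form belonging to a coset. -/
def cosetForm (x : SqrtCoset D) : ℂ → ℂ := pellForm D x.out⁻¹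

lemma exists_mk_out_eq (D : ℕ) (g : SL(2, ℤ)) :
    ∃ h ∈ sqrtStabilizer D, (QuotientGroup.mk g : SqrtCoset D).out⁻¹ = h * g⁻¹ := by
  obtain ⟨h, hh⟩ := QuotientGroup.mk_out_eq_mul (sqrtStabilizer D) g
  exact ⟨(h : SL(2, ℤ))⁻¹, inv_mem h.2, by rw [hh, mul_inv_rev]⟩

lemma cosetForm_mk (hD : ¬ IsSquare D) (g : SL(2, ℤ)) :
    cosetForm (QuotientGroup.mk g : SqrtCoset D) = pellForm D g⁻¹ := by
  obtain ⟨h, hh, h1⟩ := exists_mk_out_eq D g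
  rw [cosetForm, h1, pellForm_mul_of_mem hD hh]

lemma norm_cosetForm_ge (hD : ¬ IsSquare D) (x : SqrtCoset D) (z : UpperHalfPlane) :
    z.im * (EisensteinSeries.r z * ‖cosetVec x‖) ≤ 2 * ‖cosetForm x z‖ := by
  refine le_trans ?_ (im_mul_norm_le_pellForm hD x.out⁻¹ z.im_pos)
  have := EisensteinSeries.r_mul_max_le z (cosetVec_ne_zero hD x)
  exact mul_le_mul_of_nonneg_left this z.im_pos.le

lemma cosetForm_ne_zero (hD : ¬ IsSquare D) (x : SqrtCoset D) (z : UpperHalfPlane) :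
    cosetForm x z ≠ 0 := by
  intro h
  have := norm_cosetForm_ge hD x z
  rw [h, norm_zero, mul_zero] at this
  have h1 := z.im_pos
  have h2 := EisensteinSeries.r_pos z
  have h3 := norm_pos_iff.2 (cosetVec_ne_zero hD x)
  have : 0 < z.im * (EisensteinSeries.r z * ‖cosetVec x‖) := by positivity
  linarith

lemma norm_cosetForm_pow_inv_le (hD : ¬ IsSquare D) (x : SqrtCoset D) {A B : ℝ} (hB : 0 < B)
    {z : UpperHalfPlane} (hz : z ∈ UpperHalfPlane.verticalStrip A B) :
    ‖(cosetForm x z ^ 5)⁻¹‖ ≤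
      (2 / z.im) ^ 5 * (EisensteinSeries.r ⟨⟨A, B⟩, hB⟩ ^ 5)⁻¹ * (‖cosetVec x‖ ^ 5)⁻¹ := by
  have h0 := norm_cosetForm_ge hD x z
  have hr := EisensteinSeries.r_lower_bound_on_verticalStrip z hB hz
  have h1 := z.im_pos
  have h2 := EisensteinSeries.r_pos ⟨⟨A, B⟩, hB⟩
  have h3 := norm_pos_iff.2 (cosetVec_ne_zero hD x)
  have h4 : z.im / 2 * EisensteinSeries.r ⟨⟨A, B⟩, hB⟩ * ‖cosetVec x‖ ≤ ‖cosetForm x z‖ := by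
    have : z.im * (EisensteinSeries.r ⟨⟨A, B⟩, hB⟩ * ‖cosetVec x‖) ≤
      z.im * (EisensteinSeries.r z * ‖cosetVec x‖) := by gcongr
    linarith
  rw [norm_inv, norm_pow]
  calc (‖cosetForm x z‖ ^ 5)⁻¹
      ≤ ((z.im / 2 * EisensteinSeries.r ⟨⟨A, B⟩, hB⟩ * ‖cosetVec x‖) ^ 5)⁻¹ := by gcongr
    _ = _ := by field_simp

/-- The Poincaré series `∑ Q(z, 1)⁻⁵` over the forms equivalent to `x² - Dy²`. -/
def poincareSeries (D : ℕ) (z : ℂ) : ℂ := ∑' x : SqrtCoset D, (cosetForm x z ^ 5)⁻¹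

lemma poincareSeries_smul (hD : ¬ IsSquare D) (γ : SL(2, ℤ)) (z : UpperHalfPlane) :
    poincareSeries D ((γ • z : UpperHalfPlane) : ℂ) =
      ((γ 1 0 : ℂ) * z + γ 1 1) ^ (10 : ℤ) * poincareSeries D z := by
  have hd : (γ 1 0 : ℂ) * z + γ 1 1 ≠ 0 := UpperHalfPlane.denom_ne_zero γ z
  rw [poincareSeries, poincareSeries, ← tsum_mul_left,
    ← Equiv.tsum_eq (MulAction.toPerm γ : Equiv.Perm (SqrtCoset D))]
  refine tsum_congr fun x => ?_
  have hx : (MulAction.toPerm γ : Equiv.Perm (SqrtCoset D)) x =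
      QuotientGroup.mk (γ * x.out) := by
    conv_lhs => rw [← QuotientGroup.out_eq' x]
    rfl
  have key : ∀ g : SL(2, ℤ), pellForm D (g * γ) z = ((γ 1 0 : ℂ) * z + γ 1 1) ^ 2 *
      pellForm D g ((γ • z : UpperHalfPlane) : ℂ) := by
    intro g
    rw [UpperHalfPlane.coe_specialLinearGroup_apply]
    simp only [pellForm, SL2_mul_apply, algebraMap_int_eq, eq_intCast, Complex.ofReal_intCast]
    push_cast
    field_simp
    ring
  rw [hx, cosetForm_mk hD, cosetForm, mul_inv_rev]
  have := key (x.out⁻¹ * γ⁻¹)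
  rw [inv_mul_cancel_right] at this
  rw [this, mul_pow, mul_inv, ← pow_mul, ← mul_assoc]
  norm_cast
  rw [mul_inv_cancel₀ (pow_ne_zero _ hd), one_mul]

lemma differentiableOn_poincareSeries (hD : ¬ IsSquare D) :
    DifferentiableOn ℂ (poincareSeries D) {z : ℂ | 0 < z.im} := by
  intro z hz
  have hz' : 0 < z.im := hz
  set U : Set ℂ := {w : ℂ | |w.re| < |z.re| + 1 ∧ z.im / 2 < w.im} with hU
  have hUo : IsOpen U :=
    (isOpen_lt (Complex.continuous_re.abs) continuous_const).inter
      (isOpen_lt continuous_const Complex.continuous_im)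
  have hzU : z ∈ U := ⟨by linarith, by linarith⟩
  have hB : 0 < z.im / 2 := by linarith
  set c : ℝ := EisensteinSeries.r ⟨⟨|z.re| + 1, z.im / 2⟩, hB⟩
  have hc : 0 < c := EisensteinSeries.r_pos _
  have hsum : Summable fun x : SqrtCoset D =>
      (2 / (z.im / 2)) ^ 5 * (c ^ 5)⁻¹ * (‖cosetVec x‖ ^ 5)⁻¹ :=
    (summable_norm_cosetVec hD).mul_left _
  refine ((differentiableOn_tsum_of_summable_norm hsum ?_ hUo ?_).differentiableAt
    (hUo.mem_nhds hzU)).differentiableWithinAt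
  · intro x w hw
    have hw' : 0 < w.im := hB.trans hw.2
    have := cosetForm_ne_zero hD x ⟨w, hw'⟩
    refine DifferentiableAt.differentiableWithinAt (DifferentiableAt.inv ?_ (pow_ne_zero _ this))
    unfold cosetForm pellForm
    fun_prop
  · intro x w hw
    have hw' : 0 < w.im := hB.trans hw.2
    refine (norm_cosetForm_pow_inv_le hD x hB (z := ⟨w, hw'⟩) ⟨hw.1.le, hw.2.le⟩).trans ?_
    have h2 : z.im / 2 ≤ w.im := hw.2.le
    change (2 / w.im) ^ 5 * (c ^ 5)⁻¹ * (‖cosetVec x‖ ^ 5)⁻¹ ≤ _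
    gcongr

lemma norm_poincareSeries_le (hD : ¬ IsSquare D) : ∃ K : ℝ, ∀ z : UpperHalfPlane, 1 ≤ z.im →
    ‖poincareSeries D z‖ ≤ (2 / z.im) ^ 5 * K := by
  set c : ℝ := EisensteinSeries.r ⟨⟨1, 1⟩, one_pos⟩
  have hc : 0 < c := EisensteinSeries.r_pos _
  refine ⟨∑' x : SqrtCoset D, (c ^ 5)⁻¹ * (‖cosetVec x‖ ^ 5)⁻¹, fun z hz => ?_⟩
  obtain ⟨n, hn⟩ := UpperHalfPlane.ModularGroup_T_zpow_mem_verticalStrip z (N := 1) one_pos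
  simp only [Nat.cast_one, one_mul] at hn
  set w : UpperHalfPlane := ModularGroup.T ^ n • z with hw
  have him : w.im = z.im := by
    rw [hw, UpperHalfPlane.modular_T_zpow_smul]
    simp
  have hinv : poincareSeries D w = poincareSeries D z := by
    rw [hw, poincareSeries_smul hD]
    simp [ModularGroup.coe_T_zpow]
  rw [← hinv, ← him]
  have hwS : w ∈ UpperHalfPlane.verticalStrip 1 1 := ⟨hn.1, by rw [him]; exact hz⟩
  have hs := (summable_norm_cosetVec hD).mul_left ((2 / w.im) ^ 5 * (c ^ 5)⁻¹)
  have hb := fun x => norm_cosetForm_pow_inv_le hD x one_pos hwS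
  refine (tsum_of_norm_bounded hs.hasSum hb).trans_eq ?_
  rw [← tsum_mul_left]
  exact tsum_congr fun x => mul_assoc _ _ _

lemma isZeroAtImInfty_poincareSeries (hD : ¬ IsSquare D) :
    UpperHalfPlane.IsZeroAtImInfty fun z : UpperHalfPlane => poincareSeries D z := by
  obtain ⟨K, hK⟩ := norm_poincareSeries_le hD
  have hlim : Tendsto (fun z : UpperHalfPlane => (2 / z.im) ^ 5 * K) UpperHalfPlane.atImInfty
      (𝓝 0) := by
    have h1 : Tendsto (fun y : ℝ => (2 / y) ^ 5 * K) atTop (𝓝 0) := by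
      have := ((tendsto_const_nhds (x := (2 : ℝ))).div_atTop tendsto_id).pow 5
      simpa using this.mul_const K
    exact h1.comp tendsto_comap
  refine squeeze_zero_norm' ?_ hlim
  have : ∀ᶠ z : UpperHalfPlane in UpperHalfPlane.atImInfty, 1 ≤ z.im :=
    tendsto_comap.eventually (eventually_ge_atTop 1)
  filter_upwards [this] with z hz using hK z hz

/-- The Poincaré series is a cusp form of weight 10 and level one. -/
def poincareCuspForm (hD : ¬ IsSquare D) : CuspForm 𝒮ℒ 10 where
  toFun z := poincareSeries D z
  slash_action_eq' := by
    rintro _ ⟨γ, rfl⟩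
    change (fun z : UpperHalfPlane => poincareSeries D z) ∣[(10 : ℤ)] γ = _
    ext z
    rw [ModularForm.slash_action_eq'_iff]
    exact poincareSeries_smul hD γ z
  holo' := UpperHalfPlane.mdifferentiable_iff.2
    ((differentiableOn_poincareSeries hD).congr fun z hz => by
      simp [UpperHalfPlane.ofComplex_apply_of_im_pos hz])
  zero_at_cusps' {c} hc := by
    rw [Subgroup.IsArithmetic.isCusp_iff_isCusp_SL2Z] at hc
    rw [OnePoint.isZeroAt_iff_forall_SL2Z hc]
    intro γ _
    have : (fun z : UpperHalfPlane => poincareSeries D z) ∣[(10 : ℤ)] γ =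
        fun z : UpperHalfPlane => poincareSeries D z := by
      ext z
      rw [ModularForm.slash_action_eq'_iff]
      exact poincareSeries_smul hD γ z
    rw [this]
    exact isZeroAtImInfty_poincareSeries hD

/-- There are no cusp forms of weight 10. -/
lemma poincareSeries_eq_zero (hD : ¬ IsSquare D) (z : UpperHalfPlane) :
    poincareSeries D z = 0 := by
  have h := rank_zero_iff.1 (CuspForm.rank_eq_zero_of_weight_lt_twelve (k := 10) (by norm_num))
  have h1 : poincareCuspForm hD = 0 := Subsingleton.elim _ _
  exact congrArg (fun f : CuspForm 𝒮ℒ 10 => f z) h1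

/-! ### Uniqueness of the principal branch of the hypergeometric function -/

lemma isOpen_one_sub_mem_slitPlane : IsOpen {z : ℂ | 1 - z ∈ slitPlane} :=
  isOpen_slitPlane.preimage (by fun_prop : Continuous fun z : ℂ => 1 - z)

lemma isPreconnected_one_sub_mem_slitPlane : IsPreconnected {z : ℂ | 1 - z ∈ slitPlane} := by
  have h : {z : ℂ | 1 - z ∈ slitPlane} = (fun z : ℂ => 1 - z) '' slitPlane := by
    ext z
    refine ⟨fun hz => ⟨1 - z, hz, by ring⟩, ?_⟩
    rintro ⟨w, hw, rfl⟩
    simpa using hw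
  rw [h]
  exact (starConvex_one_slitPlane.isPathConnected
    one_mem_slitPlane).isConnected.isPreconnected.image _
      (by fun_prop : Continuous fun z : ℂ => 1 - z).continuousOn

lemma neBot_nhdsWithin_im_one_sub (x : ℝ) : (𝓝[{z : ℂ | 0 < (1 - z).im}] (x : ℂ)).NeBot := by
  rw [← mem_closure_iff_nhdsWithin_neBot]
  have h : Tendsto (fun t : ℝ => (x : ℂ) - t * I) (𝓝[>] 0) (𝓝 (x : ℂ)) := by
    have : Tendsto (fun t : ℝ => (x : ℂ) - t * I) (𝓝 0) (𝓝 ((x : ℂ) - (0 : ℝ) * I)) :=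
      Continuous.tendsto (by fun_prop) 0
    simpa using this.mono_left nhdsWithin_le_nhds
  refine mem_closure_of_tendsto h ?_
  filter_upwards [self_mem_nhdsWithin] with t ht
  simpa using ht

lemma IsPrincipalHypergeometric.eqOn {a b c : ℂ} {F G : ℂ → ℂ}
    (hF : IsPrincipalHypergeometric a b c F) (hG : IsPrincipalHypergeometric a b c G) :
    Set.EqOn F G {z : ℂ | 1 - z ∈ slitPlane} := by
  refine AnalyticOnNhd.eqOn_of_preconnected_of_eventuallyEq
    (hF.2.1.analyticOnNhd isOpen_one_sub_mem_slitPlane)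
    (hG.2.1.analyticOnNhd isOpen_one_sub_mem_slitPlane)
    isPreconnected_one_sub_mem_slitPlane (z₀ := 0) (by simp) ?_
  filter_upwards [Metric.ball_mem_nhds (0 : ℂ) one_pos] with z hz
  have hz' : ‖z‖ < 1 := by simpa using hz
  rw [hF.1 z hz', hG.1 z hz']

lemma one_sub_mem_slitPlane_of_im_pos {z : ℂ} (hz : 0 < (1 - z).im) : 1 - z ∈ slitPlane :=
  Or.inr hz.ne'

lemma hypergeometricPV_eq {a b c : ℂ} {F : ℂ → ℂ} (hF : IsPrincipalHypergeometric a b c F)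
    {x : ℝ} (hx : x ≠ 1) : hypergeometricPV a b c x = F x := by
  have h : ∃ F : ℂ → ℂ, IsPrincipalHypergeometric a b c F := ⟨F, hF⟩
  rw [hypergeometricPV, dif_pos h]
  have hG := h.choose_spec
  rcases lt_or_gt_of_ne hx with hx | hx
  · refine hG.eqOn hF ?_
    have : (1 : ℂ) - x = ((1 - x : ℝ) : ℂ) := by push_cast; ring
    rw [Set.mem_ofPred_eq, this, ofReal_mem_slitPlane]
    linarith
  · have := neBot_nhdsWithin_im_one_sub x
    refine tendsto_nhds_unique (hG.2.2 x hx) ((hF.2.2 x hx).congr' ?_)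
    filter_upwards [self_mem_nhdsWithin] with z hz
    exact hF.eqOn hG (one_sub_mem_slitPlane_of_im_pos hz)

/-! ### Euler's integral for `₂F₁(5, 5; 10; z)` -/

/-- The integrand of Euler's integral for `₂F₁(5, 5; 10; 1 - v)` after the substitution
`t = 1 / (1 + eʷ)`. -/
def eulerKernel (v w : ℂ) : ℂ := (Complex.exp w / ((1 + Complex.exp w) * (v + Complex.exp w))) ^ 5

/-- Euler's integral without its factor `1 / B(5, 5)`. -/
def eulerIntegral (z : ℂ) : ℂ := ∫ t in (0 : ℝ)..1, ((t : ℂ) * (1 - t)) ^ 4 / (1 - z * t) ^ 5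

lemma eulerIntegral_eq_integral_eulerKernel (z : ℂ) :
    eulerIntegral z = ∫ s : ℝ, eulerKernel (1 - z) s := by
  rw [eulerIntegral, intervalIntegral.integral_of_le zero_le_one,
    MeasureTheory.integral_Ioc_eq_integral_Ioo, ← Real.range_sigmoid, ← Set.image_univ,
    integral_image_eq_integral_abs_deriv_smul MeasurableSet.univ
      (fun x _ => (Real.hasDerivAt_sigmoid x).hasDerivWithinAt) Real.sigmoid_injective.injOn,
    setIntegral_univ, ← MeasureTheory.integral_neg_eq_self]
  refine integral_congr_ae (ae_of_all _ fun s => ?_)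
  have h0 := Real.sigmoid_pos (-s)
  have h1 := Real.sigmoid_lt_one (-s)
  have he : (1 : ℝ) + Real.exp s ≠ 0 := by positivity
  simp only [eulerKernel]
  rw [abs_of_pos (by nlinarith)]
  rw [Real.sigmoid_def, neg_neg, real_smul]
  push_cast
  have he' : (1 : ℂ) + Complex.exp s ≠ 0 := by exact_mod_cast he
  have e1 : (1 : ℂ) - z * (1 + Complex.exp s)⁻¹ =
      (1 - z + Complex.exp s) / (1 + Complex.exp s) := by
    field_simp
    ring
  have e2 : (1 : ℂ) - (1 + Complex.exp s)⁻¹ = Complex.exp s / (1 + Complex.exp s) := by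
    field_simp
    ring
  rw [e1, e2]
  by_cases h : 1 - z + Complex.exp s = 0
  · simp [h]
  · field_simp

lemma one_sub_mul_ne_zero {z : ℂ} (hz : 1 - z ∈ slitPlane) {t : ℝ} (ht : t ∈ Set.Icc (0 : ℝ) 1) :
    1 - z * t ≠ 0 := by
  have h := starConvex_one_slitPlane hz (sub_nonneg.2 ht.2) ht.1 (by ring)
  have h2 : (1 - t) • (1 : ℂ) + t • (1 - z) = 1 - z * t := by
    simp only [real_smul]
    push_cast
    ring
  rw [h2] at h
  exact slitPlane_ne_zero h

lemma differentiableOn_eulerIntegral :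
    DifferentiableOn ℂ eulerIntegral {z : ℂ | 1 - z ∈ slitPlane} := by
  intro z₀ hz₀
  obtain ⟨ε, hε, hball⟩ := Metric.nhds_basis_closedBall.mem_iff.1
    (isOpen_one_sub_mem_slitPlane.mem_nhds hz₀)
  have hK : IsCompact (Metric.closedBall z₀ ε ×ˢ Set.Icc (0 : ℝ) 1) :=
    (isCompact_closedBall _ _).prod isCompact_Icc
  have hne : ∀ p ∈ Metric.closedBall z₀ ε ×ˢ Set.Icc (0 : ℝ) 1, 1 - p.1 * (p.2 : ℂ) ≠ 0 :=
    fun p hp => one_sub_mul_ne_zero (hball hp.1) hp.2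
  set F' : ℂ → ℝ → ℂ := fun z t => 5 * t * ((t : ℂ) * (1 - t)) ^ 4 / (1 - z * t) ^ 6 with hF'
  have hF'c : ContinuousOn (fun p : ℂ × ℝ => F' p.1 p.2)
      (Metric.closedBall z₀ ε ×ˢ Set.Icc (0 : ℝ) 1) :=
    ContinuousOn.div (by fun_prop) (by fun_prop) fun p hp => pow_ne_zero _ (hne p hp)
  obtain ⟨M, hM⟩ := hK.exists_bound_of_continuousOn hF'c
  have hIoc : ∀ t ∈ Set.uIoc (0 : ℝ) 1, t ∈ Set.Icc (0 : ℝ) 1 := fun t ht => by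
    rw [Set.uIoc_of_le zero_le_one] at ht
    exact ⟨ht.1.le, ht.2⟩
  have hFc : ∀ z ∈ Metric.closedBall z₀ ε, ContinuousOn
      (fun t : ℝ => ((t : ℂ) * (1 - t)) ^ 4 / (1 - z * t) ^ 5) (Set.Icc 0 1) := fun z hz =>
    ContinuousOn.div (by fun_prop) (by fun_prop) fun t ht => pow_ne_zero _ (hne (z, t) ⟨hz, ht⟩)
  have hz₀' : z₀ ∈ Metric.closedBall z₀ ε := Metric.mem_closedBall_self hε.le
  have hF'z : ContinuousOn (F' z₀) (Set.Icc 0 1) :=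
    ContinuousOn.div (by fun_prop) (by fun_prop) fun t ht => pow_ne_zero _ (hne (z₀, t) ⟨hz₀', ht⟩)
  have hmeas : ∀ f : ℝ → ℂ, ContinuousOn f (Set.Icc 0 1) →
      AEStronglyMeasurable f (volume.restrict (Set.uIoc 0 1)) := fun f hf => by
    rw [Set.uIoc_of_le zero_le_one]
    exact (hf.mono Set.Ioc_subset_Icc_self).aestronglyMeasurable measurableSet_Ioc
  refine (intervalIntegral.hasDerivAt_integral_of_dominated_loc_of_deriv_le (F' := F')
    (s := Metric.closedBall z₀ ε) (bound := fun _ => M)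
    (Metric.closedBall_mem_nhds z₀ hε) ?_ ?_ (hmeas _ hF'z) ?_ ?_
    ?_).2.differentiableAt.differentiableWithinAt
  · filter_upwards [Metric.closedBall_mem_nhds z₀ hε] with z hz using hmeas _ (hFc z hz)
  · exact ContinuousOn.intervalIntegrable (by
      rw [Set.uIcc_of_le zero_le_one]; exact hFc z₀ hz₀')
  · exact ae_of_all _ fun t ht z hz => hM (z, t) ⟨hz, hIoc t ht⟩
  · exact intervalIntegrable_const
  · refine ae_of_all _ fun t ht z hz => ?_
    have h1 := hne (z, t) ⟨hz, hIoc t ht⟩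
    have h2 : HasDerivAt (fun w : ℂ => 1 - w * t) (-t) z := by
      simpa using ((hasDerivAt_id z).mul_const (t : ℂ)).const_sub 1
    refine ((hasDerivAt_const z (((t : ℂ) * (1 - t)) ^ 4)).fun_div (h2.fun_pow 5)
      (pow_ne_zero _ h1)).congr_deriv ?_
    simp only [hF']
    field_simp
    norm_num
    ring

lemma betaFn_five_five : betaFn 5 5 = 1 / 630 := by
  have h5 : Complex.Gamma 5 = 24 := by
    rw [show (5 : ℂ) = (4 : ℕ) + 1 by norm_num, Complex.Gamma_nat_eq_factorial]
    norm_num [Nat.factorial]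
  have h10 : Complex.Gamma 10 = 362880 := by
    rw [show (10 : ℂ) = (9 : ℕ) + 1 by norm_num, Complex.Gamma_nat_eq_factorial]
    norm_num [Nat.factorial]
  rw [betaFn, h5, show (5 : ℂ) + 5 = 10 by norm_num, h10]
  norm_num

lemma integral_pow_mul_one_sub_pow (n : ℕ) :
    ∫ t in (0 : ℝ)..1, (t : ℂ) ^ (n + 4) * (1 - t) ^ 4 =
      ((n + 4).factorial * 24 : ℂ) / (n + 9).factorial := by
  have h := Complex.Gamma_mul_Gamma_eq_betaIntegral (s := n + 5) (t := 5)
    (by simp; positivity) (by simp)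
  have e1 : Complex.Gamma (n + 5) = (n + 4).factorial := by
    rw [← Complex.Gamma_nat_eq_factorial]
    push_cast
    ring_nf
  have e2 : Complex.Gamma 5 = 24 := by
    rw [show (5 : ℂ) = (4 : ℕ) + 1 by norm_num, Complex.Gamma_nat_eq_factorial]
    norm_num [Nat.factorial]
  have e3 : Complex.Gamma (n + 5 + 5) = (n + 9).factorial := by
    rw [← Complex.Gamma_nat_eq_factorial]
    push_cast
    ring_nf
  rw [e1, e2, e3] at h
  rw [eq_div_iff (by exact_mod_cast Nat.factorial_ne_zero _), h, mul_comm, Complex.betaIntegral]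
  congr 1
  refine intervalIntegral.integral_congr fun t _ => ?_
  have e4 : (n + 5 - 1 : ℂ) = ((n + 4 : ℕ) : ℂ) := by push_cast; ring
  have e5 : (5 - 1 : ℂ) = ((4 : ℕ) : ℂ) := by norm_num
  simp only [e4, e5, Complex.cpow_natCast]

lemma hypergeometricCoefficient_eq (n : ℕ) :
    ordinaryHypergeometricCoefficient (5 : ℂ) 5 10 n =
      630 * ((n + 4).choose 4 * (((n + 4).factorial * 24 : ℂ) / (n + 9).factorial)) := by
  have hcast : ∀ m : ℕ, (ascPochhammer ℂ n).eval ((m + 1 : ℕ) : ℂ) * (m.factorial : ℂ) =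
      (m + n).factorial := by
    intro m
    rw [← ascPochhammer_eval_cast, ascPochhammer_nat_eq_ascFactorial, ← Nat.cast_mul, mul_comm,
      Nat.factorial_mul_ascFactorial]
  have e1 : (24 : ℂ) * (ascPochhammer ℂ n).eval 5 = (n + 4).factorial := by
    rw [add_comm n 4, ← hcast 4, mul_comm]
    norm_num [Nat.factorial]
  have e2 : (362880 : ℂ) * (ascPochhammer ℂ n).eval 10 = (n + 9).factorial := by
    rw [add_comm n 9, ← hcast 9, mul_comm]
    norm_num [Nat.factorial]
  have e3 : ((n + 4).choose 4 : ℂ) * (n.factorial * 24) = (n + 4).factorial := by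
    rw [← Nat.add_choose_mul_factorial_mul_factorial n 4]
    push_cast [Nat.factorial]
    ring
  have hn : (n.factorial : ℂ) ≠ 0 := by exact_mod_cast Nat.factorial_ne_zero _
  have h4 : ((n + 4).factorial : ℂ) ≠ 0 := by exact_mod_cast Nat.factorial_ne_zero _
  have h9 : ((n + 9).factorial : ℂ) ≠ 0 := by exact_mod_cast Nat.factorial_ne_zero _
  have hP : (ascPochhammer ℂ n).eval 10 ≠ 0 := by
    intro h
    rw [h, mul_zero] at e2
    exact h9 e2.symm
  rw [ordinaryHypergeometricCoefficient, ← e2]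
  rw [← e2] at h9
  have e4 : (ascPochhammer ℂ n).eval 5 = (n + 4).factorial / 24 := by
    rw [← e1]; ring
  rw [e4, ← e3]
  field_simp
  ring

lemma eulerIntegral_eq_ordinaryHypergeometric {z : ℂ} (hz : ‖z‖ < 1) :
    630 * eulerIntegral z = ordinaryHypergeometric (5 : ℂ) 5 10 z := by
  have hI : ∀ t ∈ Set.uIoc (0 : ℝ) 1, 0 ≤ t ∧ t ≤ 1 := fun t ht => by
    rw [Set.uIoc_of_le zero_le_one] at ht
    exact ⟨ht.1.le, ht.2⟩
  have hsum : Summable fun n : ℕ => ((n + 4).choose 4 : ℝ) * ‖z‖ ^ n :=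
    summable_choose_mul_geometric_of_norm_lt_one 4 (by simpa using hz)
  have key : HasSum (fun n : ℕ => ∫ t in (0 : ℝ)..1,
      ((n + 4).choose 4 : ℂ) * z ^ n * ((t : ℂ) ^ (n + 4) * (1 - t) ^ 4)) (eulerIntegral z) := by
    refine intervalIntegral.hasSum_integral_of_dominated_convergence
      (fun n _ => ((n + 4).choose 4 : ℝ) * ‖z‖ ^ n) (fun n => ?_) (fun n => ?_) ?_ ?_ ?_
    · exact Continuous.aestronglyMeasurable (by fun_prop)
    · refine ae_of_all _ fun t ht => ?_
      obtain ⟨h0, h1⟩ := hI t ht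
      have e : ‖(1 - t : ℂ)‖ = 1 - t := by
        rw [← Complex.ofReal_one, ← Complex.ofReal_sub, Complex.norm_of_nonneg (by linarith)]
      rw [norm_mul, norm_mul, norm_mul, norm_pow, norm_pow, norm_pow, e,
        Complex.norm_of_nonneg h0, Complex.norm_natCast]
      refine mul_le_of_le_one_right (by positivity) ?_
      exact mul_le_one₀ (pow_le_one₀ h0 h1) (pow_nonneg (by linarith) _)
        (pow_le_one₀ (by linarith) (by linarith))
    · exact ae_of_all _ fun t _ => hsum
    · exact intervalIntegrable_const
    · refine ae_of_all _ fun t ht => ?_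
      obtain ⟨h0, h1⟩ := hI t ht
      have hzt : ‖z * t‖ < 1 := by
        rw [norm_mul, Complex.norm_of_nonneg h0]
        exact (mul_le_of_le_one_right (norm_nonneg _) h1).trans_lt hz
      have := (hasSum_choose_mul_geometric_of_norm_lt_one 4 hzt).mul_left (((t : ℂ) * (1 - t)) ^ 4)
      rw [mul_one_div] at this
      refine this.congr_fun fun n => ?_
      rw [mul_pow, mul_pow, pow_add]
      ring
  rw [ordinaryHypergeometric_eq_tsum]
  refine ((key.mul_left 630).tsum_eq.symm.trans (tsum_congr fun n => ?_))
  have := hypergeometricCoefficient_eq n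
  rw [ordinaryHypergeometricCoefficient] at this
  rw [intervalIntegral.integral_const_mul, integral_pow_mul_one_sub_pow, this, smul_eq_mul]
  ring

/-! ### Rotating the path of integration -/

lemma integrable_exp_neg_abs_pow (M : ℝ) :
    Integrable fun s : ℝ => (M * Real.exp (-|s|)) ^ 5 := by
  refine (integrable_inv_one_add_sq.const_mul (|M| ^ 5)).mono'
    (Continuous.aestronglyMeasurable (by fun_prop)) (ae_of_all _ fun s => ?_)
  rw [Real.norm_eq_abs, abs_pow, abs_mul, Real.abs_exp, mul_pow]
  gcongr
  have h1 : 1 + s ^ 2 ≤ Real.exp |s| ^ 5 := by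
    rw [← Real.exp_nat_mul]
    have := Real.quadratic_le_exp_of_nonneg (x := ((5 : ℕ) : ℝ) * |s|) (by positivity)
    refine le_trans ?_ this
    have h2 := abs_nonneg s
    have h3 := sq_abs s
    push_cast
    nlinarith
  rw [Real.exp_neg, inv_pow]
  exact inv_anti₀ (by positivity) h1

lemma norm_eulerKernel_le {v w : ℂ} {c : ℝ} (hc : 0 < c) (hre : 0 ≤ (Complex.exp w).re)
    (h1 : c ≤ ‖v + Complex.exp w‖) (h2 : c * ‖Complex.exp w‖ ≤ ‖v + Complex.exp w‖) :
    ‖eulerKernel v w‖ ≤ (c⁻¹ * Real.exp (-|w.re|)) ^ 5 := by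
  rw [eulerKernel, norm_pow]
  refine pow_le_pow_left₀ (norm_nonneg _) ?_ 5
  have h3 : 1 ≤ ‖1 + Complex.exp w‖ := by
    refine le_trans ?_ ((le_abs_self _).trans (Complex.abs_re_le_norm _))
    simp [hre]
  have h4 : ‖Complex.exp w‖ ≤ ‖1 + Complex.exp w‖ := by
    rw [← sq_le_sq₀ (norm_nonneg _) (norm_nonneg _), Complex.sq_norm, Complex.sq_norm,
      Complex.normSq_apply, Complex.normSq_apply]
    simp only [Complex.add_re, Complex.one_re, Complex.add_im, Complex.one_im]
    nlinarith
  have hρ := Complex.norm_exp w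
  have hpos : 0 < ‖Complex.exp w‖ := by rw [hρ]; positivity
  rw [norm_div, norm_mul]
  rcases le_total 0 w.re with h | h
  · rw [abs_of_nonneg h, Real.exp_neg, ← hρ, ← mul_inv]
    calc _ ≤ ‖Complex.exp w‖ / (‖Complex.exp w‖ * (c * ‖Complex.exp w‖)) := by gcongr
      _ = _ := by field_simp
  · rw [abs_of_nonpos h, neg_neg, ← hρ]
    calc _ ≤ ‖Complex.exp w‖ / (1 * c) := by gcongr
      _ = _ := by field_simp

/-- Euler's integral over the path `u = i eˢ` instead of `u = eˢ`. -/
def rotatedIntegral (v : ℂ) : ℂ := ∫ s : ℝ, eulerKernel v (s + (Real.pi / 2 : ℝ) * I)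

lemma exp_add_pi_div_two_mul_I (s : ℝ) :
    Complex.exp (s + (Real.pi / 2 : ℝ) * I) = I * Real.exp s := by
  rw [Complex.exp_add]
  push_cast
  rw [Complex.exp_pi_div_two_mul_I, mul_comm]

lemma continuous_eulerKernel_comp {v : ℂ} {f : ℝ → ℂ} (hf : Continuous f)
    (h1 : ∀ s, 1 + Complex.exp (f s) ≠ 0) (h2 : ∀ s, v + Complex.exp (f s) ≠ 0) :
    Continuous fun s => eulerKernel v (f s) := by
  unfold eulerKernel
  exact ((by fun_prop : Continuous fun s => Complex.exp (f s)).div (by fun_prop)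
    fun s => mul_ne_zero (h1 s) (h2 s)).pow 5

lemma exists_lower_bound_first_quadrant {v : ℂ} (hv : 0 < v.im ∨ (0 < v.re ∧ 0 ≤ v.im)) :
    ∃ c : ℝ, 0 < c ∧ ∀ u : ℂ, 0 ≤ u.re → 0 ≤ u.im → c ≤ ‖v + u‖ ∧ c * ‖u‖ ≤ ‖v + u‖ := by
  obtain ⟨c, hc, h⟩ : ∃ c : ℝ, 0 < c ∧ ∀ u : ℂ, 0 ≤ u.re → 0 ≤ u.im → c ≤ ‖v + u‖ := by
    rcases hv with hv | ⟨hv, -⟩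
    · refine ⟨v.im, hv, fun u _ hu => ?_⟩
      refine le_trans ?_ ((le_abs_self _).trans (Complex.abs_im_le_norm _))
      simpa using hu
    · refine ⟨v.re, hv, fun u hu _ => ?_⟩
      refine le_trans ?_ ((le_abs_self _).trans (Complex.abs_re_le_norm _))
      simpa using hu
  refine ⟨min c (1 + ‖v‖ / c)⁻¹, by positivity, fun u h1 h2 => ⟨(min_le_left _ _).trans
    (h u h1 h2), ?_⟩⟩
  have h3 : ‖u‖ ≤ (1 + ‖v‖ / c) * ‖v + u‖ := by
    have h4 : ‖u‖ ≤ ‖v + u‖ + ‖v‖ := by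
      have := norm_sub_le (v + u) v
      simpa using this
    have h5 : ‖v‖ ≤ ‖v‖ / c * ‖v + u‖ := by
      rw [div_mul_eq_mul_div, le_div_iff₀ hc]
      exact mul_le_mul_of_nonneg_left (h u h1 h2) (norm_nonneg _)
    linarith
  calc _ ≤ (1 + ‖v‖ / c)⁻¹ * ‖u‖ := by gcongr; exact min_le_right _ _
    _ ≤ _ := by
      rw [inv_mul_le_iff₀ (by positivity)]
      exact h3

lemma exp_re_im_nonneg {w : ℂ} (h0 : 0 ≤ w.im) (h1 : w.im ≤ Real.pi / 2) :
    0 ≤ (Complex.exp w).re ∧ 0 ≤ (Complex.exp w).im := by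
  rw [Complex.exp_re, Complex.exp_im]
  have hpi := Real.pi_pos
  exact ⟨mul_nonneg (Real.exp_pos _).le (Real.cos_nonneg_of_neg_pi_div_two_le_of_le
    (by linarith) h1), mul_nonneg (Real.exp_pos _).le (Real.sin_nonneg_of_nonneg_of_le_pi h0
    (by linarith))⟩

/-- Cauchy's theorem: the path `u = eˢ` may be rotated through the first quadrant, where `-v` does
not lie. -/
lemma integral_eulerKernel_eq_rotatedIntegral {v : ℂ} (hv : 0 < v.im ∨ (0 < v.re ∧ 0 ≤ v.im)) :
    ∫ s : ℝ, eulerKernel v s = rotatedIntegral v := by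
  obtain ⟨c, hc, hcv⟩ := exists_lower_bound_first_quadrant hv
  have hpi := Real.pi_pos
  have hb : ∀ w : ℂ, 0 ≤ w.im → w.im ≤ Real.pi / 2 →
      ‖eulerKernel v w‖ ≤ (c⁻¹ * Real.exp (-|w.re|)) ^ 5 := fun w h0 h1 => by
    obtain ⟨h2, h3⟩ := exp_re_im_nonneg h0 h1
    obtain ⟨h4, h5⟩ := hcv _ h2 h3
    exact norm_eulerKernel_le hc h2 h4 h5
  have hne : ∀ w : ℂ, 0 ≤ w.im → w.im ≤ Real.pi / 2 →
      1 + Complex.exp w ≠ 0 ∧ v + Complex.exp w ≠ 0 := fun w h0 h1 => by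
    obtain ⟨h2, h3⟩ := exp_re_im_nonneg h0 h1
    refine ⟨fun h => ?_, fun h => ?_⟩
    · have := congrArg Complex.re h
      simp at this
      linarith
    · have := (hcv _ h2 h3).1
      rw [h, norm_zero] at this
      linarith
  have hint : ∀ y : ℝ, 0 ≤ y → y ≤ Real.pi / 2 →
      Integrable fun s : ℝ => eulerKernel v (s + y * I) := fun y h0 h1 => by
    have him : ∀ s : ℝ, ((s : ℂ) + y * I).im = y := fun s => by simp
    have hre : ∀ s : ℝ, ((s : ℂ) + y * I).re = s := fun s => by simp
    refine (integrable_exp_neg_abs_pow c⁻¹).mono' (Continuous.aestronglyMeasurable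
      (continuous_eulerKernel_comp (by fun_prop)
        (fun s => (hne _ (by rw [him]; exact h0) (by rw [him]; exact h1)).1)
        fun s => (hne _ (by rw [him]; exact h0) (by rw [him]; exact h1)).2))
      (ae_of_all _ fun s => ?_)
    have := hb (s + y * I) (by rw [him]; exact h0) (by rw [him]; exact h1)
    rwa [hre] at this
  have h0 := hint 0 le_rfl (by positivity)
  have h1 := hint (Real.pi / 2) (by positivity) le_rfl
  have l0 := intervalIntegral_tendsto_integral h0 tendsto_neg_atTop_atBot tendsto_id
  have l1 := intervalIntegral_tendsto_integral h1 tendsto_neg_atTop_atBot tendsto_id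
  have hvert : ∀ T : ℝ, ‖∫ y : ℝ in (0 : ℝ)..(Real.pi / 2), eulerKernel v (T + y * I)‖ ≤
      (c⁻¹ * Real.exp (-|T|)) ^ 5 * (Real.pi / 2) := fun T => by
    have := intervalIntegral.norm_integral_le_of_norm_le_const (a := 0) (b := Real.pi / 2)
      (f := fun y : ℝ => eulerKernel v (T + y * I)) (C := (c⁻¹ * Real.exp (-|T|)) ^ 5)
      fun y hy => by
        rw [Set.uIoc_of_le (by positivity)] at hy
        have := hb (T + y * I) (by simp [hy.1.le]) (by simp [hy.2])
        simpa using this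
    rwa [sub_zero, abs_of_pos (show 0 < Real.pi / 2 by positivity)] at this
  have hlim : Tendsto (fun T : ℝ => (c⁻¹ * Real.exp (-|T|)) ^ 5 * (Real.pi / 2)) atTop (𝓝 0) := by
    have h2 : Tendsto (fun T : ℝ => Real.exp (-|T|)) atTop (𝓝 0) :=
      Real.tendsto_exp_neg_atTop_nhds_zero.comp tendsto_abs_atTop_atTop
    have := ((h2.const_mul c⁻¹).pow 5).mul_const (Real.pi / 2)
    simpa using this
  have lr : Tendsto (fun T : ℝ => ∫ y : ℝ in (0 : ℝ)..(Real.pi / 2), eulerKernel v (T + y * I))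
      atTop (𝓝 0) := squeeze_zero_norm hvert hlim
  have ll : Tendsto (fun T : ℝ => ∫ y : ℝ in (0 : ℝ)..(Real.pi / 2),
      eulerKernel v ((-T : ℝ) + y * I)) atTop (𝓝 0) :=
    squeeze_zero_norm (fun T => by simpa using hvert (-T)) hlim
  have hrect : ∀ T : ℝ, (∫ x : ℝ in (-T)..T, eulerKernel v (x + (0 : ℝ) * I)) -
      (∫ x : ℝ in (-T)..T, eulerKernel v (x + (Real.pi / 2 : ℝ) * I)) +
      I • (∫ y : ℝ in (0 : ℝ)..(Real.pi / 2), eulerKernel v (T + y * I)) -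
      I • (∫ y : ℝ in (0 : ℝ)..(Real.pi / 2), eulerKernel v ((-T : ℝ) + y * I)) = 0 := by
    intro T
    have := Complex.integral_boundary_rect_eq_zero_of_differentiableOn (eulerKernel v)
      ⟨-T, 0⟩ ⟨T, Real.pi / 2⟩ ?_
    · exact this
    · intro w hw
      have hw2 : w.im ∈ Set.Icc 0 (Real.pi / 2) := by
        have := hw.2
        rwa [Set.mem_preimage, Set.uIcc_of_le (by positivity)] at this
      obtain ⟨n1, n2⟩ := hne w hw2.1 hw2.2
      unfold eulerKernel
      exact (((Complex.differentiable_exp w).div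
        (((Complex.differentiable_exp w).const_add 1).mul
          ((Complex.differentiable_exp w).const_add v))
        (mul_ne_zero n1 n2)).pow 5).differentiableWithinAt
  have ltot := (((l0.sub l1).add (lr.const_smul I)).sub (ll.const_smul I)).congr hrect
  have := tendsto_nhds_unique ltot tendsto_const_nhds
  rw [smul_zero, add_zero, sub_zero, sub_eq_zero] at this
  rw [rotatedIntegral, ← this]
  simp

lemma norm_add_I_mul_ge {v : ℂ} (hv : 0 ≤ v.im) (s : ℝ) :
    |v.re| ≤ ‖v + I * Real.exp s‖ ∧ Real.exp s ≤ ‖v + I * Real.exp s‖ := by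
  constructor
  · have := Complex.abs_re_le_norm (v + I * Real.exp s)
    simpa [-ofReal_exp] using this
  · have := (le_abs_self _).trans (Complex.abs_im_le_norm (v + I * Real.exp s))
    refine le_trans ?_ this
    simp [-ofReal_exp, hv]

lemma norm_eulerKernel_rotated_le {v : ℂ} {c : ℝ} (hc : 0 < c) (hc1 : c ≤ 1) (hcv : c ≤ |v.re|)
    (hv : 0 ≤ v.im) (s : ℝ) :
    ‖eulerKernel v (s + (Real.pi / 2 : ℝ) * I)‖ ≤ (c⁻¹ * Real.exp (-|s|)) ^ 5 := by
  obtain ⟨h1, h2⟩ := norm_add_I_mul_ge hv s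
  have := norm_eulerKernel_le (v := v) (w := s + (Real.pi / 2 : ℝ) * I) hc
    (by rw [exp_add_pi_div_two_mul_I]; simp [-ofReal_exp])
    (by rw [exp_add_pi_div_two_mul_I]; exact hcv.trans h1)
    (by
      rw [exp_add_pi_div_two_mul_I, norm_mul, Complex.norm_I, one_mul,
        Complex.norm_of_nonneg (Real.exp_pos s).le]
      exact (mul_le_of_le_one_left (Real.exp_pos s).le hc1).trans h2)
  simpa using this

lemma rotated_ne_zero {v : ℂ} (hv : 0 ≤ v.im) (s : ℝ) :
    v + Complex.exp (s + (Real.pi / 2 : ℝ) * I) ≠ 0 := by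
  rw [exp_add_pi_div_two_mul_I, ← norm_pos_iff]
  exact (Real.exp_pos s).trans_le (norm_add_I_mul_ge hv s).2

lemma continuous_eulerKernel_rotated {v : ℂ} (hv : 0 ≤ v.im) :
    Continuous fun s : ℝ => eulerKernel v (s + (Real.pi / 2 : ℝ) * I) :=
  continuous_eulerKernel_comp (by fun_prop) (fun s => rotated_ne_zero (by simp) s)
    fun s => rotated_ne_zero hv s

lemma integrable_eulerKernel_rotated {v : ℝ} (hv : v ≠ 0) :
    Integrable fun s : ℝ => eulerKernel v (s + (Real.pi / 2 : ℝ) * I) := by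
  have hc : 0 < min 1 |v| := lt_min one_pos (abs_pos.2 hv)
  exact (integrable_exp_neg_abs_pow (min 1 |v|)⁻¹).mono'
    (continuous_eulerKernel_rotated (by simp)).aestronglyMeasurable
    (ae_of_all _ fun s => norm_eulerKernel_rotated_le hc (min_le_left _ _)
      (by simp) (by simp) s)

lemma continuousWithinAt_rotatedIntegral {v : ℝ} (hv : v ≠ 0) :
    ContinuousWithinAt rotatedIntegral {w : ℂ | 0 ≤ w.im} v := by
  set c : ℝ := min 1 (|v| / 2) with hc
  have hc0 : 0 < c := lt_min one_pos (by have := abs_pos.2 hv; positivity)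
  have hnhds : ∀ᶠ w : ℂ in 𝓝[{w : ℂ | 0 ≤ w.im}] v, c ≤ |w.re| := by
    have h1 : ∀ᶠ w : ℂ in 𝓝 (v : ℂ), |v| / 2 < |w.re| := by
      refine (Complex.continuous_re.abs.tendsto (v : ℂ)).eventually_const_lt ?_
      have := abs_pos.2 hv
      rw [Complex.ofReal_re]
      linarith
    filter_upwards [nhdsWithin_le_nhds h1] with w hw using (min_le_right _ _).trans hw.le
  refine continuousWithinAt_of_dominated (bound := fun s => (c⁻¹ * Real.exp (-|s|)) ^ 5) ?_ ?_
    (integrable_exp_neg_abs_pow _) ?_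
  · filter_upwards [self_mem_nhdsWithin] with w hw
    exact (continuous_eulerKernel_rotated hw).aestronglyMeasurable
  · filter_upwards [self_mem_nhdsWithin, hnhds] with w hw hw2
    exact ae_of_all _ fun s => norm_eulerKernel_rotated_le hc0 (min_le_left _ _) hw2 hw s
  · refine ae_of_all _ fun s => ContinuousAt.continuousWithinAt ?_
    have h1 : 1 + Complex.exp (s + (Real.pi / 2 : ℝ) * I) ≠ 0 := rotated_ne_zero (by simp) s
    have h2 : (v : ℂ) + Complex.exp (s + (Real.pi / 2 : ℝ) * I) ≠ 0 := rotated_ne_zero (by simp) s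
    unfold eulerKernel
    have h3 : ContinuousAt (fun w : ℂ => (1 + Complex.exp (s + (Real.pi / 2 : ℝ) * I)) *
        (w + Complex.exp (s + (Real.pi / 2 : ℝ) * I))) v := by
      fun_prop
    exact (ContinuousAt.div₀ continuousAt_const h3 (mul_ne_zero h1 h2)).pow 5

open scoped Classical in
/-- The principal branch of `₂F₁(5, 5; 10; z)`. -/
def principalHypergeometric (z : ℂ) : ℂ :=
  if 1 - z ∈ slitPlane then 630 * eulerIntegral z else 630 * rotatedIntegral (1 - z)

lemma isPrincipalHypergeometric_principalHypergeometric :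
    IsPrincipalHypergeometric 5 5 10 principalHypergeometric := by
  refine ⟨fun z hz => ?_, ?_, fun x hx => ?_⟩
  · have : 1 - z ∈ slitPlane := by
      rw [sub_eq_add_neg]
      exact mem_slitPlane_of_norm_lt_one (by rwa [norm_neg])
    rw [principalHypergeometric, if_pos this, eulerIntegral_eq_ordinaryHypergeometric hz]
  · refine (differentiableOn_eulerIntegral.const_mul 630).congr fun z hz => ?_
    rw [principalHypergeometric, if_pos (show 1 - z ∈ slitPlane from hz)]
  · have hx' : (1 - x : ℝ) ≠ 0 := by linarith
    have h1 : (1 : ℂ) - x ∉ slitPlane := by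
      have : (1 : ℂ) - x = ((1 - x : ℝ) : ℂ) := by push_cast; ring
      rw [this, ofReal_mem_slitPlane]
      linarith
    have h2 : Tendsto (fun z : ℂ => 1 - z) (𝓝[{z : ℂ | 0 < (1 - z).im}] (x : ℂ))
        (𝓝[{w : ℂ | 0 ≤ w.im}] ((1 - x : ℝ) : ℂ)) := by
      refine tendsto_nhdsWithin_iff.2 ⟨?_, ?_⟩
      · have : Tendsto (fun z : ℂ => 1 - z) (𝓝 (x : ℂ)) (𝓝 (1 - x)) :=
          Continuous.tendsto (by fun_prop) _
        push_cast
        exact this.mono_left nhdsWithin_le_nhds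
      · filter_upwards [self_mem_nhdsWithin] with z hz
        exact le_of_lt (show 0 < (1 - z).im from hz)
    have h3 := ((continuousWithinAt_rotatedIntegral hx').tendsto.comp h2).const_mul 630
    rw [principalHypergeometric, if_neg h1]
    push_cast at h3
    refine h3.congr' ?_
    filter_upwards [self_mem_nhdsWithin] with z hz
    rw [principalHypergeometric, if_pos (one_sub_mem_slitPlane_of_im_pos hz),
      eulerIntegral_eq_integral_eulerKernel, integral_eulerKernel_eq_rotatedIntegral (Or.inl hz)]
    rfl

lemma hypergeometricPV_five_five_ten {v : ℝ} (hv : v ≠ 0) :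
    hypergeometricPV 5 5 10 ((1 - v : ℝ) : ℂ) = 630 * rotatedIntegral v := by
  rw [hypergeometricPV_eq isPrincipalHypergeometric_principalHypergeometric
    (by contrapose! hv; linarith), principalHypergeometric]
  have e : (1 : ℂ) - ((1 - v : ℝ) : ℂ) = v := by push_cast; ring
  rw [e]
  split_ifs with h
  · rw [ofReal_mem_slitPlane] at h
    rw [eulerIntegral_eq_integral_eulerKernel, e,
      integral_eulerKernel_eq_rotatedIntegral (Or.inr ⟨by simpa using h, by simp⟩)]
  · rfl

/-- The substitution `u ↦ 1 / u`. -/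
lemma eulerKernel_inv {v : ℂ} (hv : v ≠ 0) (w : ℂ) :
    eulerKernel v⁻¹ (-w) = v ^ 5 * eulerKernel v w := by
  rw [eulerKernel, eulerKernel, ← mul_pow, Complex.exp_neg]
  congr 1
  have h := Complex.exp_ne_zero w
  have e1 : 1 + (Complex.exp w)⁻¹ = (1 + Complex.exp w) / Complex.exp w := by
    field_simp
    ring
  have e2 : v⁻¹ + (Complex.exp w)⁻¹ = (v + Complex.exp w) / (v * Complex.exp w) := by
    field_simp
    ring
  rw [e1, e2]
  by_cases h1 : 1 + Complex.exp w = 0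
  · simp [h1]
  by_cases h2 : v + Complex.exp w = 0
  · simp [h2]
  field_simp

/-- For `v > 0` it does not matter in which direction the path is rotated. -/
lemma rotatedIntegral_inv {v : ℝ} (hv : 0 < v) :
    rotatedIntegral (v⁻¹ : ℝ) = v ^ 5 * rotatedIntegral v := by
  have h1 : 0 < v⁻¹ := inv_pos.2 hv
  rw [← integral_eulerKernel_eq_rotatedIntegral (Or.inr ⟨by simpa using h1, by simp⟩),
    ← integral_eulerKernel_eq_rotatedIntegral (Or.inr ⟨by simpa using hv, by simp⟩),
    ← integral_const_mul, ← integral_neg_eq_self]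
  refine integral_congr_ae (ae_of_all _ fun s => ?_)
  have := eulerKernel_inv (v := v) (by exact_mod_cast hv.ne') s
  push_cast
  exact this

/-! ### The forms along the geodesic from `-√D` to `√D` -/

/-- The value `(aw + b)(cw + d) / w` at `w = i eˢ`, where `(a, b; c, d) = σ_η⁻¹ γ σ_η`. -/
def geodesicForm (D : ℕ) (γ : SL(2, ℤ)) (s : ℝ) : ℂ :=
  ((sqrtScaled D γ 0 0 * sqrtScaled D γ 1 1 + sqrtScaled D γ 0 1 * sqrtScaled D γ 1 0 : ℝ) : ℂ) +
    ((sqrtScaled D γ 0 0 * sqrtScaled D γ 1 0 * Real.exp s -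
      sqrtScaled D γ 0 1 * sqrtScaled D γ 1 1 * Real.exp (-s) : ℝ) : ℂ) * I

lemma continuous_geodesicForm (γ : SL(2, ℤ)) : Continuous (geodesicForm D γ) := by
  unfold geodesicForm
  fun_prop

lemma sqrtScaled_mul_apply (hD : ¬ IsSquare D) (γ δ : SL(2, ℤ)) (i j : Fin 2) :
    sqrtScaled D (γ * δ) i j =
      sqrtScaled D γ i 0 * sqrtScaled D δ 0 j + sqrtScaled D γ i 1 * sqrtScaled D δ 1 j := by
  rw [sqrtScaled_mul hD, Matrix.mul_apply, Fin.sum_univ_two]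

lemma sqrtScaled_mul_row_of_mem (hD : ¬ IsSquare D) {h : SL(2, ℤ)} (hh : h ∈ sqrtStabilizer D)
    (γ : SL(2, ℤ)) (j l : Fin 2) : sqrtScaled D (h * γ) 0 j * sqrtScaled D (h * γ) 1 l =
      sqrtScaled D γ 0 j * sqrtScaled D γ 1 l := by
  obtain ⟨-, -, h1, h2⟩ := sqrtScaled_of_mem hD hh
  have h3 := sqrtScaled_det hD h
  rw [h1, zero_mul, sub_zero] at h3
  rw [sqrtScaled_mul_apply hD, sqrtScaled_mul_apply hD, h1, h2]
  linear_combination (sqrtScaled D γ 0 j * sqrtScaled D γ 1 l) * h3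

lemma sqrtScaled_mul_col_of_mem (hD : ¬ IsSquare D) {h : SL(2, ℤ)} (hh : h ∈ sqrtStabilizer D)
    (γ : SL(2, ℤ)) (i k : Fin 2) : sqrtScaled D (γ * h) i 0 * sqrtScaled D (γ * h) k 1 =
      sqrtScaled D γ i 0 * sqrtScaled D γ k 1 := by
  obtain ⟨-, -, h1, h2⟩ := sqrtScaled_of_mem hD hh
  have h3 := sqrtScaled_det hD h
  rw [h1, zero_mul, sub_zero] at h3
  rw [sqrtScaled_mul_apply hD, sqrtScaled_mul_apply hD, h1, h2]
  linear_combination (sqrtScaled D γ i 0 * sqrtScaled D γ k 1) * h3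

lemma geodesicForm_mul_of_mem (hD : ¬ IsSquare D) {h : SL(2, ℤ)} (hh : h ∈ sqrtStabilizer D)
    (γ : SL(2, ℤ)) : geodesicForm D (h * γ) = geodesicForm D γ := by
  ext s
  simp only [geodesicForm, sqrtScaled_mul_row_of_mem hD hh]

/-- The product `ad` and the condition `abcd ≠ 0` only depend on the double coset. -/
lemma sqrtScaled_diag_mul_of_mem (hD : ¬ IsSquare D) {h h' : SL(2, ℤ)}
    (hh : h ∈ sqrtStabilizer D) (hh' : h' ∈ sqrtStabilizer D) (γ : SL(2, ℤ)) :
    sqrtScaled D (h * γ * h') 0 0 * sqrtScaled D (h * γ * h') 1 1 =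
      sqrtScaled D γ 0 0 * sqrtScaled D γ 1 1 := by
  rw [sqrtScaled_mul_col_of_mem hD hh', sqrtScaled_mul_row_of_mem hD hh]

lemma isGeneric_mul_of_mem (hD : ¬ IsSquare D) {h h' : SL(2, ℤ)}
    (hh : h ∈ sqrtStabilizer D) (hh' : h' ∈ sqrtStabilizer D) (γ : SL(2, ℤ)) :
    IsGeneric D (h * γ * h') ↔ IsGeneric D γ := by
  have e : ∀ g, sqrtScaled D g 0 0 * sqrtScaled D g 0 1 * sqrtScaled D g 1 0 * sqrtScaled D g 1 1 =
      (sqrtScaled D g 0 0 * sqrtScaled D g 1 1) * (sqrtScaled D g 1 0 * sqrtScaled D g 0 1) :=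
    fun g => by ring
  rw [IsGeneric, IsGeneric, e, e, sqrtScaled_mul_col_of_mem hD hh',
    sqrtScaled_mul_col_of_mem hD hh',
    sqrtScaled_mul_row_of_mem hD hh, mul_comm (sqrtScaled D (h * γ) 1 0),
    sqrtScaled_mul_row_of_mem hD hh, mul_comm (sqrtScaled D γ 0 1)]

lemma geodesicForm_mul_right (hD : ¬ IsSquare D) {h : SL(2, ℤ)} (hh : h ∈ sqrtStabilizer D)
    {t : ℝ} (h0 : sqrtScaled D h 0 0 = Real.exp t) (h1 : sqrtScaled D h 1 1 = Real.exp (-t))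
    (γ : SL(2, ℤ)) (s : ℝ) : geodesicForm D (γ * h) s = geodesicForm D γ (s + 2 * t) := by
  obtain ⟨-, -, h2, h3⟩ := sqrtScaled_of_mem hD hh
  have e := sqrtScaled_mul_col_of_mem hD hh γ
  have e1 : ∀ i, sqrtScaled D (γ * h) i 0 = sqrtScaled D γ i 0 * Real.exp t := fun i => by
    rw [sqrtScaled_mul_apply hD, h3, h0]; ring
  have e2 : ∀ i, sqrtScaled D (γ * h) i 1 = sqrtScaled D γ i 1 * Real.exp (-t) := fun i => by
    rw [sqrtScaled_mul_apply hD, h2, h1]; ring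
  have e3 : Real.exp (s + 2 * t) = Real.exp t * Real.exp t * Real.exp s := by
    rw [← Real.exp_add, ← Real.exp_add]; ring_nf
  have e4 : Real.exp (-(s + 2 * t)) = Real.exp (-t) * Real.exp (-t) * Real.exp (-s) := by
    rw [← Real.exp_add, ← Real.exp_add]; ring_nf
  rw [geodesicForm, geodesicForm, e 0 1, mul_comm (sqrtScaled D (γ * h) 0 1), e 1 0,
    mul_comm (sqrtScaled D γ 0 1)  (sqrtScaled D γ 1 0), e1, e1, e2, e2, e3, e4]
  congr 3
  ring

/-- The point `σ_η(i eˢ)` of the geodesic. -/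
def geodesicPoint (D : ℕ) (s : ℝ) : ℂ :=
  √(D : ℝ) * (I * Real.exp s - 1) / (I * Real.exp s + 1)

lemma I_mul_exp_add_one_ne_zero (s : ℝ) : I * (Real.exp s : ℂ) + 1 ≠ 0 := by
  intro h
  have := congrArg Complex.re h
  simp [-ofReal_exp] at this

lemma geodesicPoint_im_pos (hD : ¬ IsSquare D) (s : ℝ) : 0 < (geodesicPoint D s).im := by
  have hr := sqrt_natCast_pos hD
  have he := Real.exp_pos s
  rw [geodesicPoint, Complex.div_im]
  simp only [Complex.normSq_apply, Complex.mul_re, Complex.mul_im, Complex.add_re, Complex.add_im,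
    Complex.sub_re, Complex.sub_im, Complex.I_re, Complex.I_im, Complex.ofReal_re,
    Complex.ofReal_im, Complex.one_re, Complex.one_im]
  ring_nf
  positivity

lemma pellForm_geodesicPoint (hD : ¬ IsSquare D) (γ : SL(2, ℤ)) (s : ℝ) :
    pellForm D γ (geodesicPoint D s) =
      -4 * D * (I * Real.exp s) / (I * Real.exp s + 1) ^ 2 * geodesicForm D γ s := by
  have hr : ((√(D : ℝ) : ℝ) : ℂ) ≠ 0 := by exact_mod_cast (sqrt_natCast_pos hD).ne'
  have h2 : ((√(D : ℝ) : ℝ) : ℂ) ^ 2 = D := by exact_mod_cast sq_sqrt_natCast D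
  have hw := I_mul_exp_add_one_ne_zero s
  have hK : (I * Real.exp s) * geodesicForm D γ s =
      ((sqrtScaled D γ 0 0 : ℂ) * (I * Real.exp s) + sqrtScaled D γ 0 1) *
        ((sqrtScaled D γ 1 0 : ℂ) * (I * Real.exp s) + sqrtScaled D γ 1 1) := by
    have he : (Real.exp s : ℂ) * Real.exp (-s) = 1 := by
      rw [← Complex.ofReal_mul, ← Real.exp_add]; simp
    rw [geodesicForm]
    push_cast [-ofReal_exp]
    linear_combination (-(sqrtScaled D γ 0 1 : ℂ) * sqrtScaled D γ 1 1 * I ^ 2) * he -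
      (sqrtScaled D γ 0 1 : ℂ) * sqrtScaled D γ 1 1 * I_sq
  have e : -4 * D * (I * Real.exp s) / (I * Real.exp s + 1) ^ 2 * geodesicForm D γ s =
      -4 * D * ((I * Real.exp s) * geodesicForm D γ s) / (I * Real.exp s + 1) ^ 2 := by ring
  rw [e, hK, pellForm, geodesicPoint]
  generalize I * (Real.exp s : ℂ) = w at *
  rw [sqrtScaled_eq hD]
  simp only [Matrix.smul_apply, Matrix.of_apply, Matrix.cons_val', Matrix.cons_val_zero,
    Matrix.cons_val_one, Matrix.cons_val_fin_one, smul_eq_mul]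
  push_cast
  generalize ((√(D : ℝ) : ℝ) : ℂ) = r at *
  rw [← h2]
  field_simp
  ring

/-- The integrand of the cycle integral belonging to `γ`. -/
def cycleKernel (D : ℕ) (γ : SL(2, ℤ)) (s : ℝ) : ℂ := (geodesicForm D γ s ^ 5)⁻¹

lemma cycleKernel_mul_of_mem (hD : ¬ IsSquare D) {h : SL(2, ℤ)} (hh : h ∈ sqrtStabilizer D)
    (γ : SL(2, ℤ)) : cycleKernel D (h * γ) = cycleKernel D γ := by
  ext s
  rw [cycleKernel, cycleKernel, geodesicForm_mul_of_mem hD hh]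

lemma cycleKernel_mk_out (hD : ¬ IsSquare D) (g : SL(2, ℤ)) :
    cycleKernel D (QuotientGroup.mk g : SqrtCoset D).out⁻¹ = cycleKernel D g⁻¹ := by
  obtain ⟨h, hh, h1⟩ := exists_mk_out_eq D g
  rw [h1, cycleKernel_mul_of_mem hD hh]

lemma geodesicFactor_ne_zero (hD : ¬ IsSquare D) (s : ℝ) :
    -4 * (D : ℂ) * (I * Real.exp s) / (I * Real.exp s + 1) ^ 2 ≠ 0 := by
  have hw := I_mul_exp_add_one_ne_zero s
  have h1 : (D : ℂ) ≠ 0 := by exact_mod_cast (pos_of_not_isSquare hD).ne'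
  have h2 : (Real.exp s : ℂ) ≠ 0 := by exact_mod_cast (Real.exp_pos s).ne'
  exact div_ne_zero (mul_ne_zero (mul_ne_zero (by norm_num) h1) (mul_ne_zero I_ne_zero h2))
    (pow_ne_zero _ hw)

lemma geodesicForm_ne_zero (hD : ¬ IsSquare D) (γ : SL(2, ℤ)) (s : ℝ) :
    geodesicForm D γ s ≠ 0 := by
  intro h
  have h1 := pellForm_geodesicPoint hD γ s
  have h2 := cosetForm_ne_zero hD (QuotientGroup.mk γ⁻¹) ⟨_, geodesicPoint_im_pos hD s⟩
  rw [cosetForm_mk hD, inv_inv] at h2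
  rw [h, mul_zero] at h1
  exact h2 h1

lemma continuous_cycleKernel (hD : ¬ IsSquare D) (γ : SL(2, ℤ)) :
    Continuous (cycleKernel D γ) :=
  ((continuous_geodesicForm γ).pow 5).inv₀ fun s => pow_ne_zero _ (geodesicForm_ne_zero hD γ s)

lemma cycleKernel_eq (hD : ¬ IsSquare D) (γ : SL(2, ℤ)) (s : ℝ) :
    cycleKernel D γ s = (-4 * D * (I * Real.exp s) / (I * Real.exp s + 1) ^ 2) ^ 5 *
      (pellForm D γ (geodesicPoint D s) ^ 5)⁻¹ := by
  have := geodesicFactor_ne_zero hD s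
  rw [pellForm_geodesicPoint hD, cycleKernel, mul_pow, mul_inv, ← mul_assoc,
    mul_inv_cancel₀ (pow_ne_zero _ this), one_mul]

lemma tsum_cycleKernel (hD : ¬ IsSquare D) (s : ℝ) :
    ∑' x : SqrtCoset D, cycleKernel D x.out⁻¹ s = 0 := by
  simp_rw [cycleKernel_eq hD]
  rw [tsum_mul_left]
  have := poincareSeries_eq_zero hD ⟨_, geodesicPoint_im_pos hD s⟩
  rw [poincareSeries] at this
  exact mul_eq_zero_of_right _ this

lemma exists_summable_bound_cycleKernel (hD : ¬ IsSquare D) (L : ℝ) :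
    ∃ u : SqrtCoset D → ℝ, Summable u ∧
      ∀ x, ∀ s ∈ Set.Icc 0 L, ‖cycleKernel D x.out⁻¹ s‖ ≤ u x := by
  have hcont : Continuous (geodesicPoint D) := by
    unfold geodesicPoint
    exact Continuous.div (by fun_prop) (by fun_prop) I_mul_exp_add_one_ne_zero
  have hcont' : Continuous fun s => (⟨geodesicPoint D s, geodesicPoint_im_pos hD s⟩ :
      UpperHalfPlane) := UpperHalfPlane.isEmbedding_coe.continuous_iff.2 hcont
  obtain ⟨A, B, hB, hAB⟩ := UpperHalfPlane.subset_verticalStrip_of_isCompact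
    ((isCompact_Icc (a := (0 : ℝ)) (b := L)).image hcont')
  have hm : Continuous fun s : ℝ =>
      (-4 * (D : ℂ) * (I * Real.exp s) / (I * Real.exp s + 1) ^ 2) ^ 5 := by
    refine (Continuous.div (by fun_prop) (by fun_prop) fun s => ?_).pow 5
    exact pow_ne_zero _ (I_mul_exp_add_one_ne_zero s)
  obtain ⟨M, hM⟩ := (isCompact_Icc (a := (0 : ℝ)) (b := L)).exists_bound_of_continuousOn
    hm.continuousOn
  set c := EisensteinSeries.r ⟨⟨A, B⟩, hB⟩ with hc
  have hc0 : 0 < c := EisensteinSeries.r_pos _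
  refine ⟨_, (summable_norm_cosetVec hD).mul_left (M * ((2 / B) ^ 5 * (c ^ 5)⁻¹)),
    fun x s hs => ?_⟩
  rw [cycleKernel_eq hD, norm_mul, mul_assoc M]
  have hz := hAB ⟨s, hs, rfl⟩
  have h1 := norm_cosetForm_pow_inv_le hD x hB hz
  have h2 : B ≤ (geodesicPoint D s).im := hz.2
  have h3 := (geodesicPoint_im_pos hD s).le
  refine mul_le_mul (hM s hs) (h1.trans ?_) (norm_nonneg _) ((norm_nonneg _).trans (hM s hs))
  change (2 / (geodesicPoint D s).im) ^ 5 * (c ^ 5)⁻¹ * _ ≤ _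
  gcongr

/-! ### Evaluation of the cycle integrals -/

section Evaluation

variable {γ : SL(2, ℤ)}

lemma IsGeneric.ne_zero (h : IsGeneric D γ) : sqrtScaled D γ 0 0 ≠ 0 ∧ sqrtScaled D γ 0 1 ≠ 0 ∧
    sqrtScaled D γ 1 0 ≠ 0 ∧ sqrtScaled D γ 1 1 ≠ 0 := by
  simpa [IsGeneric, and_assoc] using h

/-- With `u = i (c / d) eˢ` the kernel becomes the integrand of Euler's integral on the rotated
path; for `c / d < 0` the substitution is `u = -i (d / c) e⁻ˢ` instead. -/
lemma cycleKernel_eq_eulerKernel_of_pos (h : IsGeneric D γ)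
    (hcd : 0 < sqrtScaled D γ 1 0 / sqrtScaled D γ 1 1) (s : ℝ) :
    cycleKernel D γ s = (((sqrtScaled D γ 0 0 * sqrtScaled D γ 1 1 : ℝ) : ℂ) ^ 5)⁻¹ *
      eulerKernel ((sqrtScaled D γ 0 1 * sqrtScaled D γ 1 0 /
        (sqrtScaled D γ 0 0 * sqrtScaled D γ 1 1) : ℝ) : ℂ)
        ((s + Real.log (sqrtScaled D γ 1 0 / sqrtScaled D γ 1 1) : ℝ) +
          (Real.pi / 2 : ℝ) * I) := by
  obtain ⟨ha, hb, hc, hd⟩ := h.ne_zero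
  rw [cycleKernel, geodesicForm, eulerKernel, exp_add_pi_div_two_mul_I, Real.exp_add,
    Real.exp_log hcd, Real.exp_neg]
  have he : (Real.exp s : ℂ) ≠ 0 := by exact_mod_cast (Real.exp_pos s).ne'
  generalize sqrtScaled D γ 0 0 = a at *
  generalize sqrtScaled D γ 0 1 = b at *
  generalize sqrtScaled D γ 1 0 = c at *
  generalize sqrtScaled D γ 1 1 = d at *
  generalize Real.exp s = x at *
  rw [← inv_pow, ← inv_pow, ← mul_pow]
  congr 1
  have ha : (a : ℂ) ≠ 0 := by exact_mod_cast ha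
  have hc : (c : ℂ) ≠ 0 := by exact_mod_cast hc
  have hd : (d : ℂ) ≠ 0 := by exact_mod_cast hd
  push_cast
  rw [← div_eq_inv_mul, div_div, inv_eq_one_div]
  have key : ((a * d + b * c : ℂ) + (a * c * x - b * d * (x : ℂ)⁻¹) * I) * (I * (x * (c / d))) =
      (1 + I * (x * (c / d))) * (b * c / (a * d) + I * (x * (c / d))) * (a * d) := by
    field_simp
    linear_combination (-(b * d : ℂ)) * I_sq
  rw [← key]
  have hu : I * ((x : ℂ) * (c / d)) ≠ 0 :=
    mul_ne_zero I_ne_zero (mul_ne_zero he (div_ne_zero hc hd))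
  rw [mul_comm _ (I * ((x : ℂ) * (c / d))), div_mul_eq_div_div, div_self hu]

lemma cycleKernel_eq_eulerKernel_of_neg (h : IsGeneric D γ)
    (hcd : sqrtScaled D γ 1 0 / sqrtScaled D γ 1 1 < 0) (s : ℝ) :
    cycleKernel D γ s = (((sqrtScaled D γ 0 1 * sqrtScaled D γ 1 0 : ℝ) : ℂ) ^ 5)⁻¹ *
      eulerKernel ((sqrtScaled D γ 0 0 * sqrtScaled D γ 1 1 /
        (sqrtScaled D γ 0 1 * sqrtScaled D γ 1 0) : ℝ) : ℂ)
        ((-(s + Real.log (-(sqrtScaled D γ 1 0 / sqrtScaled D γ 1 1))) : ℝ) +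
          (Real.pi / 2 : ℝ) * I) := by
  obtain ⟨ha, hb, hc, hd⟩ := h.ne_zero
  rw [cycleKernel, geodesicForm, eulerKernel, exp_add_pi_div_two_mul_I, Real.exp_neg, Real.exp_neg,
    Real.exp_add, Real.exp_log (neg_pos.2 hcd)]
  have he : (Real.exp s : ℂ) ≠ 0 := by exact_mod_cast (Real.exp_pos s).ne'
  generalize sqrtScaled D γ 0 0 = a at *
  generalize sqrtScaled D γ 0 1 = b at *
  generalize sqrtScaled D γ 1 0 = c at *
  generalize sqrtScaled D γ 1 1 = d at *
  generalize Real.exp s = x at *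
  rw [← inv_pow, ← inv_pow, ← mul_pow]
  congr 1
  have hb : (b : ℂ) ≠ 0 := by exact_mod_cast hb
  have hc : (c : ℂ) ≠ 0 := by exact_mod_cast hc
  have hd : (d : ℂ) ≠ 0 := by exact_mod_cast hd
  push_cast
  rw [← div_eq_inv_mul, div_div, inv_eq_one_div]
  have key : ((a * d + b * c : ℂ) + (a * c * x - b * d * (x : ℂ)⁻¹) * I) *
        (I * ((x : ℂ) * -((c : ℂ) / d))⁻¹) =
      (1 + I * ((x : ℂ) * -((c : ℂ) / d))⁻¹) *
        (a * d / (b * c) + I * ((x : ℂ) * -((c : ℂ) / d))⁻¹) * (b * c) := by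
    field_simp
    linear_combination (-(a * c * x ^ 2 : ℂ)) * I_sq
  rw [← key]
  have hu : I * ((x : ℂ) * -(c / d))⁻¹ ≠ 0 :=
    mul_ne_zero I_ne_zero (inv_ne_zero (mul_ne_zero he (neg_ne_zero.2 (div_ne_zero hc hd))))
  rw [mul_comm _ (I * ((x : ℂ) * -(c / d))⁻¹), div_mul_eq_div_div, div_self hu]

lemma IsGeneric.ratio_ne_zero (h : IsGeneric D γ) :
    sqrtScaled D γ 1 0 / sqrtScaled D γ 1 1 ≠ 0 :=
  div_ne_zero h.ne_zero.2.2.1 h.ne_zero.2.2.2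

lemma integrable_cycleKernel (h : IsGeneric D γ) : Integrable (cycleKernel D γ) := by
  obtain ⟨ha, hb, hc, hd⟩ := h.ne_zero
  rcases lt_or_gt_of_ne h.ratio_ne_zero with hcd | hcd
  · simp_rw [funext (cycleKernel_eq_eulerKernel_of_neg h hcd)]
    refine Integrable.const_mul ?_ _
    exact ((integrable_eulerKernel_rotated (div_ne_zero (mul_ne_zero ha hd)
      (mul_ne_zero hb hc))).comp_neg).comp_add_right _
  · simp_rw [funext (cycleKernel_eq_eulerKernel_of_pos h hcd)]
    refine Integrable.const_mul ?_ _
    exact (integrable_eulerKernel_rotated (div_ne_zero (mul_ne_zero hb hc)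
      (mul_ne_zero ha hd))).comp_add_right _

/-- The cycle integral over the whole geodesic. -/
def cycleIntegral (D : ℕ) (γ : SL(2, ℤ)) : ℂ := ∫ s : ℝ, cycleKernel D γ s

lemma cycleIntegral_of_pos (h : IsGeneric D γ)
    (hcd : 0 < sqrtScaled D γ 1 0 / sqrtScaled D γ 1 1) :
    cycleIntegral D γ = (((sqrtScaled D γ 0 0 * sqrtScaled D γ 1 1 : ℝ) : ℂ) ^ 5)⁻¹ *
      rotatedIntegral ((sqrtScaled D γ 0 1 * sqrtScaled D γ 1 0 /
        (sqrtScaled D γ 0 0 * sqrtScaled D γ 1 1) : ℝ) : ℂ) := by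
  rw [cycleIntegral, funext (cycleKernel_eq_eulerKernel_of_pos h hcd), integral_const_mul,
    rotatedIntegral]
  congr 1
  exact integral_add_right_eq_self (fun s : ℝ => eulerKernel _ ((s : ℂ) + (Real.pi / 2 : ℝ) * I)) _

lemma integral_comp_neg_add (f : ℝ → ℂ) (t : ℝ) : ∫ s : ℝ, f (-(s + t)) = ∫ s : ℝ, f s := by
  rw [integral_add_right_eq_self (fun s => f (-s)) t, integral_neg_eq_self]

lemma cycleIntegral_of_neg (h : IsGeneric D γ)
    (hcd : sqrtScaled D γ 1 0 / sqrtScaled D γ 1 1 < 0) :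
    cycleIntegral D γ = (((sqrtScaled D γ 0 1 * sqrtScaled D γ 1 0 : ℝ) : ℂ) ^ 5)⁻¹ *
      rotatedIntegral ((sqrtScaled D γ 0 0 * sqrtScaled D γ 1 1 /
        (sqrtScaled D γ 0 1 * sqrtScaled D γ 1 0) : ℝ) : ℂ) := by
  rw [cycleIntegral, funext (cycleKernel_eq_eulerKernel_of_neg h hcd), integral_const_mul,
    rotatedIntegral]
  congr 1
  generalize ((_ / _ : ℝ) : ℂ) = v
  exact integral_comp_neg_add (fun s : ℝ => eulerKernel v ((s : ℂ) + (Real.pi / 2 : ℝ) * I)) _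

variable {C : ℝ}

lemma IsGeneric.modulus_ne (hD : ¬ IsSquare D) (h : IsGeneric D γ)
    (hC : sqrtScaled D γ 0 0 * sqrtScaled D γ 1 1 = C) : C ≠ 0 ∧ C ≠ 1 ∧
      sqrtScaled D γ 0 1 * sqrtScaled D γ 1 0 = C - 1 := by
  obtain ⟨ha, hb, hc, hd⟩ := h.ne_zero
  have h1 := sqrtScaled_det hD γ
  rw [hC] at h1
  have h2 : sqrtScaled D γ 0 1 * sqrtScaled D γ 1 0 = C - 1 := by linarith
  refine ⟨hC ▸ mul_ne_zero ha hd, fun h3 => mul_ne_zero hb hc ?_, h2⟩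
  rw [h2, h3, sub_self]

lemma hypergeometricPV_one_div (hC : C ≠ 0) (hC1 : C ≠ 1) :
    hypergeometricPV 5 5 10 (1 / C) = 630 * rotatedIntegral ((C - 1) / C : ℝ) := by
  have h0 : (C : ℂ) ≠ 0 := by exact_mod_cast hC
  have h1 : (1 / C : ℂ) = ((1 - (C - 1) / C : ℝ) : ℂ) := by
    push_cast
    field_simp
    ring
  rw [h1]
  exact hypergeometricPV_five_five_ten (div_ne_zero (sub_ne_zero.2 hC1) hC)

lemma cycleIntegral_eq_of_pos (hD : ¬ IsSquare D) (h : IsGeneric D γ)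
    (hC : sqrtScaled D γ 0 0 * sqrtScaled D γ 1 1 = C)
    (hcd : 0 < sqrtScaled D γ 1 0 / sqrtScaled D γ 1 1) :
    hypergeometricPV 5 5 10 (1 / C) / (C : ℂ) ^ 5 = 630 * cycleIntegral D γ := by
  obtain ⟨h0, h1, h2⟩ := h.modulus_ne hD hC
  rw [cycleIntegral_of_pos h hcd, hypergeometricPV_one_div h0 h1, hC, h2]
  ring

lemma cycleIntegral_eq_of_neg (hD : ¬ IsSquare D) (h : IsGeneric D γ)
    (hC : sqrtScaled D γ 0 0 * sqrtScaled D γ 1 1 = C)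
    (hcd : sqrtScaled D γ 1 0 / sqrtScaled D γ 1 1 < 0) :
    hypergeometricPV 5 5 10 (-1 / (C - 1)) / ((C : ℂ) - 1) ^ 5 = 630 * cycleIntegral D γ := by
  obtain ⟨h0, h1, h2⟩ := h.modulus_ne hD hC
  have h3 : C - 1 ≠ 0 := sub_ne_zero.2 h1
  have h4 : (C : ℂ) - 1 ≠ 0 := by exact_mod_cast h3
  have h5 : (-1 / (C - 1) : ℂ) = ((1 - C / (C - 1) : ℝ) : ℂ) := by
    push_cast
    field_simp
    ring
  rw [cycleIntegral_of_neg h hcd, h5, hypergeometricPV_five_five_ten (div_ne_zero h0 h3), hC, h2]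
  push_cast
  ring

/-- If `C ∉ (0, 1)`, then `bc / ad = (C - 1) / C` is positive, and the sign of `c / d` is irrelevant
by `rotatedIntegral_inv`. -/
lemma cycleIntegral_eq_of_notMem (hD : ¬ IsSquare D) (h : IsGeneric D γ)
    (hC : sqrtScaled D γ 0 0 * sqrtScaled D γ 1 1 = C) (hC' : C ∉ Set.Ioo 0 1) :
    hypergeometricPV 5 5 10 (1 / C) / (C : ℂ) ^ 5 = 630 * cycleIntegral D γ := by
  rcases lt_or_gt_of_ne h.ratio_ne_zero with hcd | hcd
  · obtain ⟨h0, h1, h2⟩ := h.modulus_ne hD hC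
    have hv : 0 < (C - 1) / C := by
      rcases lt_or_gt_of_ne h0 with h3 | h3
      · exact div_pos_of_neg_of_neg (by linarith) h3
      · refine div_pos (sub_pos.2 (lt_of_le_of_ne ?_ h1.symm)) h3
        by_contra h4
        exact hC' ⟨h3, not_le.1 h4⟩
    rw [cycleIntegral_of_neg h hcd, hypergeometricPV_one_div h0 h1, hC, h2,
      ← inv_div (C - 1) C, rotatedIntegral_inv hv]
    have h3 : (C : ℂ) - 1 ≠ 0 := by exact_mod_cast sub_ne_zero.2 h1
    push_cast
    field_simp
  · exact cycleIntegral_eq_of_pos hD h hC hcd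

end Evaluation

/-! ### Unfolding along the double cosets -/

/-- The double coset space `Γ_η \ Γ / Γ_η` for `η = (-√D, √D)`. -/
abbrev SqrtDoubleCoset (D : ℕ) : Type := HypDoubleCoset (sqrtPair D) (sqrtPair D)

/-- A generator of `Γ_η` modulo `±1`; its scaled matrix is `diag(ε_D, ε_D⁻¹)`. -/
structure IsPellGenerator (D : ℕ) (δ : SL(2, ℤ)) : Prop where
  mem : δ ∈ sqrtStabilizer D
  zpow_zero_zero : ∀ n : ℤ, sqrtScaled D (δ ^ n) 0 0 = Real.exp (n * (sqrtPairLength D / 2))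
  zpow_one_one : ∀ n : ℤ, sqrtScaled D (δ ^ n) 1 1 = Real.exp (-(n * (sqrtPairLength D / 2)))
  eq_or_eq_neg : ∀ γ ∈ sqrtStabilizer D, ∃ n : ℤ, γ = δ ^ n ∨ γ = -δ ^ n

lemma exists_isPellGenerator (hD : ¬ IsSquare D) : ∃ δ, IsPellGenerator D δ := by
  obtain ⟨δ, h1, h2, h3⟩ := exists_generator hD
  exact ⟨δ, h1, fun n => (h2 n).1, fun n => (h2 n).2, h3⟩

lemma neg_one_mem_sqrtStabilizer (hD : ¬ IsSquare D) : (-1 : SL(2, ℤ)) ∈ sqrtStabilizer D := by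
  refine mem_sqrtStabilizer_of_sqrtScaled hD (Or.inl ?_)
  rw [sqrtScaled_eq hD]
  simp

namespace IsPellGenerator

variable {δ : SL(2, ℤ)}

lemma cycleKernel_mul_zpow (hδ : IsPellGenerator D δ) (hD : ¬ IsSquare D) (γ : SL(2, ℤ)) (n : ℤ)
    (s : ℝ) : cycleKernel D (γ * δ ^ n) s = cycleKernel D γ (s + n * sqrtPairLength D) := by
  rw [cycleKernel, cycleKernel, geodesicForm_mul_right hD (zpow_mem hδ.mem n) (hδ.zpow_zero_zero n)
    (hδ.zpow_one_one n)]
  congr 3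
  ring

/-- The coset of `Γ / Γ_η` that is the inverse of `Γ_η γ δⁿ`, for the representative `γ` of a
double coset. -/
def coset (δ : SL(2, ℤ)) (q : SqrtDoubleCoset D) (n : ℤ) : SqrtCoset D :=
  QuotientGroup.mk (q.out * δ ^ n)⁻¹

lemma cycleKernel_coset (hδ : IsPellGenerator D δ) (hD : ¬ IsSquare D)
    (q : SqrtDoubleCoset D) (n : ℤ) (s : ℝ) : cycleKernel D (coset δ q n).out⁻¹ s =
      cycleKernel D q.out (s + n * sqrtPairLength D) := by
  rw [coset, cycleKernel_mk_out hD, inv_inv, hδ.cycleKernel_mul_zpow hD]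

lemma isGeneric_coset (hδ : IsPellGenerator D δ) (hD : ¬ IsSquare D)
    (q : SqrtDoubleCoset D) (n : ℤ) :
    IsGeneric D (coset δ q n).out⁻¹ ↔ IsGeneric D q.out := by
  obtain ⟨h, hh, h1⟩ := exists_mk_out_eq D (q.out * δ ^ n)⁻¹
  rw [coset, h1, inv_inv, ← mul_assoc, isGeneric_mul_of_mem hD hh (zpow_mem hδ.mem _)]

lemma exists_coset_eq (hδ : IsPellGenerator D δ) (hD : ¬ IsSquare D) (x : SqrtCoset D) :
    ∃ q n, coset δ q n = x := by
  obtain ⟨h, k, hh, hk, e⟩ :=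
    DoubleCoset.mk_out_eq_mul (sqrtStabilizer D) (sqrtStabilizer D) x.out⁻¹
  obtain ⟨m, hm⟩ := hδ.eq_or_eq_neg k hk
  refine ⟨DoubleCoset.mk (sqrtStabilizer D) (sqrtStabilizer D) x.out⁻¹, -m, ?_⟩
  conv_rhs => rw [← QuotientGroup.out_eq' x]
  rw [coset]
  refine QuotientGroup.eq.2 ?_
  rw [inv_inv, e]
  rcases hm with hm | hm
  · have : h * x.out⁻¹ * k * δ ^ (-m) * x.out = h := by
      rw [hm, zpow_neg]; group
    rwa [this]
  · have : h * x.out⁻¹ * k * δ ^ (-m) * x.out = h * -1 := by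
      rw [hm, zpow_neg]
      simp
    rw [this]
    exact mul_mem hh (neg_one_mem_sqrtStabilizer hD)

/-- The product `ac` is invariant under `Γ_η` on the left and scales with `n` on the right, so the
cosets `Γ_η γ δⁿ` are distinct if `ac ≠ 0`. -/
lemma coset_inj (hδ : IsPellGenerator D δ) (hD : ¬ IsSquare D) {q q' : SqrtDoubleCoset D}
    {n m : ℤ} (hq : IsGeneric D q.out) (e : coset δ q n = coset δ q' m) : q = q' ∧ n = m := by
  have hh := QuotientGroup.eq.1 e
  rw [inv_inv] at hh
  set h := q.out * δ ^ n * (q'.out * δ ^ m)⁻¹ with h_def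
  have e1 : q.out * δ ^ n = h * (q'.out * δ ^ m) := by rw [h_def]; group
  have hqq : q = q' := by
    rw [← DoubleCoset.out_eq' _ _ q, ← DoubleCoset.out_eq' _ _ q', DoubleCoset.eq]
    refine ⟨h⁻¹, inv_mem hh, δ ^ n * (δ ^ m)⁻¹,
      mul_mem (zpow_mem hδ.mem _) (inv_mem (zpow_mem hδ.mem _)), ?_⟩
    rw [h_def]; group
  subst hqq
  have key : ∀ j : ℤ, sqrtScaled D (q.out * δ ^ j) 0 0 * sqrtScaled D (q.out * δ ^ j) 1 0 =
      sqrtScaled D q.out 0 0 * sqrtScaled D q.out 1 0 * Real.exp (j * sqrtPairLength D) := by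
    intro j
    have h0 := (sqrtScaled_of_mem hD (zpow_mem hδ.mem j)).2.2.2
    rw [sqrtScaled_mul_apply hD, sqrtScaled_mul_apply hD, h0, hδ.zpow_zero_zero]
    have : Real.exp (j * sqrtPairLength D) =
        Real.exp (j * (sqrtPairLength D / 2)) * Real.exp (j * (sqrtPairLength D / 2)) := by
      rw [← Real.exp_add]; ring_nf
    rw [this]; ring
  have e2 := key n
  rw [e1, sqrtScaled_mul_row_of_mem hD hh, key m] at e2
  obtain ⟨ha, -, hc, -⟩ := IsGeneric.ne_zero hq
  have e3 := Real.exp_injective (mul_left_cancel₀ (mul_ne_zero ha hc) e2)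
  have e4 := mul_right_cancel₀ (sqrtPairLength_pos hD).ne' e3
  exact ⟨rfl, (Int.cast_injective e4).symm⟩

/-- A generic double coset is the disjoint union of the cosets `Γ_η γ δⁿ`: the generic cosets
correspond to the pairs of a generic double coset and an integer. -/
def genericEquiv (hδ : IsPellGenerator D δ) (hD : ¬ IsSquare D) :
    {q : SqrtDoubleCoset D // IsGeneric D q.out} × ℤ ≃
      {x : SqrtCoset D // IsGeneric D x.out⁻¹} :=
  Equiv.ofBijective
    (fun p => ⟨coset δ p.1.1 p.2, (hδ.isGeneric_coset hD _ _).2 p.1.2⟩) (by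
      constructor
      · rintro ⟨⟨q, hq⟩, n⟩ ⟨⟨q', hq'⟩, m⟩ e
        obtain ⟨rfl, rfl⟩ := hδ.coset_inj hD hq (congrArg Subtype.val e)
        rfl
      · rintro ⟨x, hx⟩
        obtain ⟨q, n, rfl⟩ := hδ.exists_coset_eq hD x
        exact ⟨(⟨q, (hδ.isGeneric_coset hD q n).1 hx⟩, n), rfl⟩)

end IsPellGenerator

lemma hasSum_intervalIntegral_comp_add_int_mul {f : ℝ → ℂ} (hf : Integrable f) {L : ℝ}
    (hL : 0 < L) : HasSum (fun n : ℤ => ∫ s in (0 : ℝ)..L, f (s + n * L)) (∫ s, f s) := by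
  have h := (((integrable_comp_mul_right_iff f hL.ne').2
    hf).hasSum_intervalIntegral_comp_add_int).const_smul L
  rw [Measure.integral_comp_mul_right, abs_inv, abs_of_pos hL, smul_smul, mul_inv_cancel₀ hL.ne',
    one_smul] at h
  refine h.congr_fun ?_
  intro n
  have := intervalIntegral.integral_comp_mul_right (a := 0) (b := 1) (fun s => f (s + n * L)) hL.ne'
  simp only [zero_mul, one_mul] at this
  simp_rw [add_mul]
  rw [this, smul_smul, mul_inv_cancel₀ hL.ne', one_smul]

lemma hasSum_intervalIntegral_cycleKernel (hD : ¬ IsSquare D) {L : ℝ} (hL : 0 < L) :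
    HasSum (fun x : SqrtCoset D => ∫ s in (0 : ℝ)..L, cycleKernel D x.out⁻¹ s) 0 := by
  obtain ⟨u, hu, hb⟩ := exists_summable_bound_cycleKernel hD L
  have : Countable (SqrtCoset D) := (cosetVec_injective hD).countable
  have hmem : ∀ s, s ∈ Set.uIoc 0 L → s ∈ Set.Icc 0 L := fun s hs => by
    rw [Set.uIoc_of_le hL.le] at hs
    exact Set.Ioc_subset_Icc_self hs
  have h := intervalIntegral.hasSum_integral_of_dominated_convergence (μ := volume) (a := 0)
    (b := L) (F := fun (x : SqrtCoset D) s => cycleKernel D x.out⁻¹ s) (f := fun _ => (0 : ℂ))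
    (fun x _ => u x) (fun x => (continuous_cycleKernel hD _).aestronglyMeasurable)
    (fun x => ae_of_all _ fun s hs => hb x s (hmem s hs)) (ae_of_all _ fun _ _ => hu) (by simp)
    (ae_of_all _ fun s hs => by
      have h1 : Summable fun x : SqrtCoset D => cycleKernel D x.out⁻¹ s :=
        hu.of_norm_bounded fun x => hb x s (hmem s hs)
      have h2 := h1.hasSum
      rwa [tsum_cycleKernel hD] at h2)
  simpa using h

lemma cycleKernel_of_mem (hD : ¬ IsSquare D) {γ : SL(2, ℤ)} (h : γ ∈ sqrtStabilizer D) (s : ℝ) :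
    cycleKernel D γ s = 1 := by
  obtain ⟨-, -, h1, h2⟩ := sqrtScaled_of_mem hD h
  have h3 := sqrtScaled_det hD γ
  rw [h1, zero_mul, sub_zero] at h3
  simp [cycleKernel, geodesicForm, h1, h2, h3]

lemma cycleKernel_of_isSwap (hD : ¬ IsSquare D) {γ : SL(2, ℤ)} (h : IsSwap D γ) (s : ℝ) :
    cycleKernel D γ s = -1 := by
  obtain ⟨h1, h2⟩ := h.sqrtScaled hD
  have h3 := sqrtScaled_det hD γ
  rw [h1, zero_mul, zero_sub] at h3
  have h4 : sqrtScaled D γ 0 1 * sqrtScaled D γ 1 0 = -1 := by linarith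
  rw [cycleKernel, geodesicForm, h1, h2, zero_mul, h4]
  norm_num

open scoped Classical in
/-- The trivial coset has kernel `1`. If some element interchanges `-√D` and `√D`, then these
elements form one further coset, with kernel `-1`, which cancels the trivial one. -/
lemma tsum_not_isGeneric (hD : ¬ IsSquare D) {L : ℝ} :
    ∑' x : ↥{x : SqrtCoset D | IsGeneric D x.out⁻¹}ᶜ, ∫ s in (0 : ℝ)..L, cycleKernel D x.1.out⁻¹ s =
      if ∃ γ, IsSwap D γ then 0 else (L : ℂ) := by
  have hmem : ∀ x : SqrtCoset D, x.out⁻¹ ∈ sqrtStabilizer D ↔ x = QuotientGroup.mk 1 := fun x => by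
    conv_rhs => rw [← QuotientGroup.out_eq' x]
    rw [QuotientGroup.eq, mul_one]
  have h1 : ∫ s in (0 : ℝ)..L, cycleKernel D (QuotientGroup.mk 1 : SqrtCoset D).out⁻¹ s = L := by
    simp [cycleKernel_of_mem hD ((hmem _).2 rfl)]
  split_ifs with hw
  · obtain ⟨w, hw⟩ := hw
    have hswap : ∀ x : SqrtCoset D, IsSwap D x.out⁻¹ ↔ x = QuotientGroup.mk w⁻¹ := fun x => by
      conv_rhs => rw [← QuotientGroup.out_eq' x]
      rw [QuotientGroup.eq]
      refine ⟨fun h => h.mul_mem hD hw.inv, fun h => ?_⟩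
      refine isSwap_of_sqrtScaled hD ?_
      obtain ⟨h2, h3⟩ := hw.sqrtScaled hD
      obtain ⟨-, -, h4, h5⟩ := sqrtScaled_of_mem hD h
      have e : x.out⁻¹ = x.out⁻¹ * w⁻¹ * w := by group
      left
      rw [e, sqrtScaled_mul_apply hD _ w, h2, h4, mul_zero, zero_mul, add_zero]
    have hne : (QuotientGroup.mk 1 : SqrtCoset D) ≠ QuotientGroup.mk w⁻¹ := fun h =>
      ((hswap _).2 h).not_mem hD ((hmem _).2 rfl)
    have hset : {x : SqrtCoset D | IsGeneric D x.out⁻¹}ᶜ =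
        (({QuotientGroup.mk 1, QuotientGroup.mk w⁻¹} : Finset (SqrtCoset D)) :
          Set (SqrtCoset D)) := by
      ext x
      rw [Set.mem_compl_iff, Set.mem_ofPred_eq, not_isGeneric_iff hD, hmem, hswap]
      simp
    rw [hset, Finset.tsum_subtype' _
      (fun x : SqrtCoset D => ∫ s in (0 : ℝ)..L, cycleKernel D x.out⁻¹ s), Finset.sum_pair hne, h1]
    simp [cycleKernel_of_isSwap hD ((hswap _).2 rfl)]
  · have hset : {x : SqrtCoset D | IsGeneric D x.out⁻¹}ᶜ =
        (({QuotientGroup.mk 1} : Finset (SqrtCoset D)) : Set (SqrtCoset D)) := by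
      ext x
      rw [Set.mem_compl_iff, Set.mem_ofPred_eq, not_isGeneric_iff hD, hmem,
        or_iff_left (fun h => hw ⟨_, h⟩)]
      simp
    rw [hset, Finset.tsum_subtype' _
      (fun x : SqrtCoset D => ∫ s in (0 : ℝ)..L, cycleKernel D x.out⁻¹ s), Finset.sum_singleton, h1]

open scoped Classical in
/-- Unfolding: the integral of the Poincaré series over a period vanishes, its nongeneric cosets are
explicit, and the others add up to integrals over the whole geodesic. -/
theorem hasSum_cycleIntegral (hD : ¬ IsSquare D) :
    HasSum (fun q : {q : SqrtDoubleCoset D // IsGeneric D q.out} => cycleIntegral D q.1.out)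
      (if ∃ γ, IsSwap D γ then 0 else -(sqrtPairLength D : ℂ)) := by
  obtain ⟨δ, hδ⟩ := exists_isPellGenerator hD
  have hL := sqrtPairLength_pos hD
  have h := hasSum_intervalIntegral_cycleKernel hD hL
  have h1 := h.summable.tsum_subtype_add_tsum_subtype_compl
    {x : SqrtCoset D | IsGeneric D x.out⁻¹}
  rw [h.tsum_eq, tsum_not_isGeneric hD] at h1
  have h2 := (h.summable.subtype {x : SqrtCoset D | IsGeneric D x.out⁻¹}).hasSum
  have h3 : ∑' x : ↥{x : SqrtCoset D | IsGeneric D x.out⁻¹},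
      ∫ s in (0 : ℝ)..(sqrtPairLength D), cycleKernel D x.1.out⁻¹ s =
        if ∃ γ, IsSwap D γ then 0 else -(sqrtPairLength D : ℂ) := by
    split_ifs at h1 ⊢
    · simpa using h1
    · exact eq_neg_of_add_eq_zero_left h1
  rw [Function.comp_def] at h2
  have h4 := (hδ.genericEquiv hD).hasSum_iff.2 (h3 ▸ h2)
  refine h4.prod_fiberwise fun q => ?_
  have h5 := hasSum_intervalIntegral_comp_add_int_mul (integrable_cycleKernel q.2) hL
  refine h5.congr_fun fun n => ?_
  refine intervalIntegral.integral_congr fun s _ => ?_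
  exact hδ.cycleKernel_coset hD q.1 n s

/-! ### Finiteness -/

/-- A generic form with `|ad| ≤ M` is bounded in terms of `M` and `L` at some point of `ℤ L`: choose
`n` with `1 ≤ |ac| exp (n L) < exp L`, and use `ac · bd = ad (ad - 1)` for the other coefficient. -/
lemma exists_norm_geodesicForm_le (hD : ¬ IsSquare D) {γ : SL(2, ℤ)} (h : IsGeneric D γ) {M L : ℝ}
    (hM : |sqrtScaled D γ 0 0 * sqrtScaled D γ 1 1| ≤ M) (hL : 0 < L) :
    ∃ n : ℤ, ‖geodesicForm D γ (n * L)‖ ≤ (2 * M + 1) + (Real.exp L + M * (M + 1)) := by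
  obtain ⟨ha, hb, hc, hd⟩ := h.ne_zero
  obtain ⟨-, -, hbc⟩ := h.modulus_ne hD rfl
  obtain ⟨n, ⟨hn1, hn2⟩, -⟩ := existsUnique_add_zsmul_mem_Ico hL
    (Real.log |sqrtScaled D γ 0 0 * sqrtScaled D γ 1 0|) 0
  refine ⟨n, ?_⟩
  rw [zsmul_eq_mul] at hn1 hn2
  rw [zero_add] at hn2
  have hac : 0 < |sqrtScaled D γ 0 0 * sqrtScaled D γ 1 0| := abs_pos.2 (mul_ne_zero ha hc)
  have e1 : Real.exp (Real.log |sqrtScaled D γ 0 0 * sqrtScaled D γ 1 0| + n * L) =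
      |sqrtScaled D γ 0 0 * sqrtScaled D γ 1 0| * Real.exp (n * L) := by
    rw [Real.exp_add, Real.exp_log hac]
  have b1 : 1 ≤ |sqrtScaled D γ 0 0 * sqrtScaled D γ 1 0| * Real.exp (n * L) := by
    rw [← e1]; exact Real.one_le_exp hn1
  have b2 : |sqrtScaled D γ 0 0 * sqrtScaled D γ 1 0| * Real.exp (n * L) ≤ Real.exp L := by
    rw [← e1]; exact Real.exp_le_exp.2 hn2.le
  have hM0 : 0 ≤ M := (abs_nonneg _).trans hM
  have hbc' : |sqrtScaled D γ 0 1 * sqrtScaled D γ 1 0| ≤ M + 1 := by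
    rw [hbc]
    exact (abs_sub _ _).trans (by simpa using hM)
  have e2 : (|sqrtScaled D γ 0 0 * sqrtScaled D γ 1 0| * Real.exp (n * L)) *
      (|sqrtScaled D γ 0 1 * sqrtScaled D γ 1 1| * Real.exp (-(n * L))) =
      |sqrtScaled D γ 0 0 * sqrtScaled D γ 1 1| * |sqrtScaled D γ 0 1 * sqrtScaled D γ 1 0| := by
    rw [Real.exp_neg]
    have := Real.exp_ne_zero (n * L)
    field_simp
    simp only [← abs_mul]
    congr 1
    ring
  have b3 : |sqrtScaled D γ 0 1 * sqrtScaled D γ 1 1| * Real.exp (-(n * L)) ≤ M * (M + 1) := by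
    calc |sqrtScaled D γ 0 1 * sqrtScaled D γ 1 1| * Real.exp (-(n * L))
        ≤ (|sqrtScaled D γ 0 0 * sqrtScaled D γ 1 0| * Real.exp (n * L)) *
          (|sqrtScaled D γ 0 1 * sqrtScaled D γ 1 1| * Real.exp (-(n * L))) :=
          le_mul_of_one_le_left (mul_nonneg (abs_nonneg _) (Real.exp_pos _).le) b1
      _ ≤ M * (M + 1) := by
        rw [e2]
        exact mul_le_mul hM hbc' (abs_nonneg _) hM0
  rw [geodesicForm]
  refine (norm_add_le _ _).trans (add_le_add ?_ ?_)
  · rw [Complex.norm_real, Real.norm_eq_abs]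
    refine (abs_add_le _ _).trans ?_
    linarith
  · rw [norm_mul, Complex.norm_I, mul_one, Complex.norm_real, Real.norm_eq_abs]
    refine (abs_sub _ _).trans ?_
    rw [abs_mul _ (Real.exp _), abs_mul _ (Real.exp _), Real.abs_exp, Real.abs_exp]
    exact add_le_add b2 b3

/-- Only finitely many terms of a convergent series exceed a given positive bound, so only finitely
many generic double cosets have bounded `ad`. -/
lemma finite_isGeneric_abs_le (hD : ¬ IsSquare D) (M : ℝ) :
    {q : SqrtDoubleCoset D | IsGeneric D q.out ∧
      |sqrtScaled D q.out 0 0 * sqrtScaled D q.out 1 1| ≤ M}.Finite := by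
  obtain ⟨δ, hδ⟩ := exists_isPellGenerator hD
  have hL := sqrtPairLength_pos hD
  obtain ⟨u, hu, hb⟩ := exists_summable_bound_cycleKernel hD 0
  set B := (2 * M + 1) + (Real.exp (sqrtPairLength D) + M * (M + 1)) with hB
  have hn : ∀ q : SqrtDoubleCoset D, ∃ n : ℤ, (IsGeneric D q.out ∧
      |sqrtScaled D q.out 0 0 * sqrtScaled D q.out 1 1| ≤ M) →
        ‖geodesicForm D q.out (n * sqrtPairLength D)‖ ≤ B := fun q => by
    by_cases h : IsGeneric D q.out ∧ |sqrtScaled D q.out 0 0 * sqrtScaled D q.out 1 1| ≤ M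
    · obtain ⟨n, hn⟩ := exists_norm_geodesicForm_le hD h.1 h.2 hL
      exact ⟨n, fun _ => hn⟩
    · exact ⟨0, fun h' => absurd h' h⟩
  choose n hn using hn
  by_cases hM : 0 ≤ M
  swap
  · convert Set.finite_empty
    ext q
    simp only [Set.mem_ofPred_eq, Set.mem_empty_iff_false, iff_false, not_and, not_le]
    intro _
    exact (not_le.1 hM).trans_le (abs_nonneg _)
  have hB0 : 0 < B := by positivity
  have hfin : {x : SqrtCoset D | (B ^ 5)⁻¹ ≤ u x}.Finite := by
    have h1 := hu.tendsto_cofinite_zero.eventually_lt_const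
      (show (0 : ℝ) < (B ^ 5)⁻¹ by positivity)
    simpa [Filter.eventually_cofinite] using h1
  refine Set.Finite.of_injOn (f := fun q => IsPellGenerator.coset δ q (n q)) ?_ ?_ hfin
  · intro q hq
    have h1 := hb (IsPellGenerator.coset δ q (n q)) 0 (by simp)
    rw [hδ.cycleKernel_coset hD, zero_add, cycleKernel, norm_inv, norm_pow] at h1
    refine le_trans ?_ h1
    have h2 : 0 < ‖geodesicForm D q.out (n q * sqrtPairLength D)‖ :=
      norm_pos_iff.2 (geodesicForm_ne_zero hD _ _)
    have h3 := hn q hq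
    exact inv_anti₀ (pow_pos h2 5) (pow_le_pow_left₀ h2.le h3 5)
  · intro q hq q' _ e
    exact (hδ.coset_inj hD hq.1 e).1

/-! ### The sums over the moduli -/

section Moduli

variable {C : ℝ}

lemma isGeneric_of_modulus {γ : SL(2, ℤ)} (hD : ¬ IsSquare D) (h0 : C ≠ 0) (h1 : C ≠ 1)
    (hC : sqrtScaled D γ 0 0 * sqrtScaled D γ 1 1 = C) : IsGeneric D γ := by
  have h := sqrtScaled_det hD γ
  rw [hC] at h
  have e : sqrtScaled D γ 0 0 * sqrtScaled D γ 0 1 * sqrtScaled D γ 1 0 * sqrtScaled D γ 1 1 =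
      C * (C - 1) := by
    linear_combination (sqrtScaled D γ 0 1 * sqrtScaled D γ 1 0) * hC - C * h
  rw [IsGeneric, e]
  exact mul_ne_zero h0 (sub_ne_zero.2 h1)

lemma ne_of_mem_hypModuli (hD : ¬ IsSquare D) (hC : C ∈ hypModuli (sqrtPair D) (sqrtPair D)) :
    C ≠ 0 ∧ C ≠ 1 := by
  obtain ⟨γ, h, h1⟩ := hC
  have := IsGeneric.modulus_ne hD h h1
  exact ⟨this.1, this.2.1⟩

lemma exists_doubleCoset_of_mem_hypModuli (hD : ¬ IsSquare D)
    (hC : C ∈ hypModuli (sqrtPair D) (sqrtPair D)) : ∃ q : SqrtDoubleCoset D,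
      IsGeneric D q.out ∧ sqrtScaled D q.out 0 0 * sqrtScaled D q.out 1 1 = C := by
  obtain ⟨γ, h, h1⟩ := hC
  obtain ⟨g, k, hg, hk, e⟩ :=
    DoubleCoset.mk_out_eq_mul (sqrtStabilizer D) (sqrtStabilizer D) γ
  refine ⟨DoubleCoset.mk (sqrtStabilizer D) (sqrtStabilizer D) γ, ?_, ?_⟩
  · rw [e, isGeneric_mul_of_mem hD hg hk]
    exact h
  · rw [e, sqrtScaled_diag_mul_of_mem hD hg hk]
    exact h1

lemma finite_hypCosets (hD : ¬ IsSquare D) (hC : C ∈ hypModuli (sqrtPair D) (sqrtPair D))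
    (α : SignType) : (hypCosets (sqrtPair D) (sqrtPair D) C α).Finite := by
  obtain ⟨h0, h1⟩ := ne_of_mem_hypModuli hD hC
  refine (finite_isGeneric_abs_le hD |C|).subset fun q hq => ?_
  have h2 : sqrtScaled D q.out 0 0 * sqrtScaled D q.out 1 1 = C := hq.1
  exact ⟨isGeneric_of_modulus hD h0 h1 h2, by rw [h2]⟩

lemma finite_hypModuli_inter_Ioo (hD : ¬ IsSquare D) :
    (hypModuli (sqrtPair D) (sqrtPair D) ∩ Set.Ioo 0 1).Finite := by
  refine ((finite_isGeneric_abs_le hD 1).image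
    fun q => sqrtScaled D q.out 0 0 * sqrtScaled D q.out 1 1).subset ?_
  rintro C ⟨hC, hC0, hC1⟩
  obtain ⟨q, h1, h2⟩ := exists_doubleCoset_of_mem_hypModuli hD hC
  refine ⟨q, ⟨h1, ?_⟩, h2⟩
  rw [h2, abs_of_pos hC0]
  exact hC1.le

/-- The sum of the cycle integrals over the double cosets with `ad = C` and `sgn(ac) = α`. -/
def cycleSum (D : ℕ) (C : ℝ) (α : SignType) : ℂ :=
  ∑ᶠ q ∈ hypCosets (sqrtPair D) (sqrtPair D) C α, cycleIntegral D q.out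

/-- For `m = n = 0` a Kloosterman sum counts double cosets. -/
lemma mul_hypKloosterman {F : ℂ} {α : SignType} {l l' : ℝ}
    (hF : ∀ q ∈ hypCosets (sqrtPair D) (sqrtPair D) C α, F = 630 * cycleIntegral D q.out) :
    F * hypKloosterman (sqrtPair D) (sqrtPair D) l l' 0 0 C α = 630 * cycleSum D C α := by
  rw [hypKloosterman, cycleSum, mul_finsum_mem, mul_finsum_mem]
  refine finsum_mem_congr rfl fun q hq => ?_
  rw [← hF q hq]
  simp [expTwoPiI]

lemma ratio_pos_of_mem_hypCosets (hC : 0 < C) {q : SqrtDoubleCoset D}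
    (hq : q ∈ hypCosets (sqrtPair D) (sqrtPair D) C 1) :
    0 < sqrtScaled D q.out 1 0 / sqrtScaled D q.out 1 1 := by
  have h1 : sqrtScaled D q.out 0 0 * sqrtScaled D q.out 1 1 = C := hq.1
  have h2 : 0 < sqrtScaled D q.out 0 0 * sqrtScaled D q.out 1 0 := sign_eq_one_iff.1 hq.2
  have ha : sqrtScaled D q.out 0 0 ≠ 0 := fun h => by simp [h] at h2
  rw [← mul_div_mul_left _ _ ha, h1]
  exact div_pos h2 hC

lemma ratio_neg_of_mem_hypCosets (hC : 0 < C) {q : SqrtDoubleCoset D}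
    (hq : q ∈ hypCosets (sqrtPair D) (sqrtPair D) C (-1)) :
    sqrtScaled D q.out 1 0 / sqrtScaled D q.out 1 1 < 0 := by
  have h1 : sqrtScaled D q.out 0 0 * sqrtScaled D q.out 1 1 = C := hq.1
  have h2 : sqrtScaled D q.out 0 0 * sqrtScaled D q.out 1 0 < 0 := sign_eq_neg_one_iff.1 hq.2
  have ha : sqrtScaled D q.out 0 0 ≠ 0 := fun h => by simp [h] at h2
  rw [← mul_div_mul_left _ _ ha, h1]
  exact div_neg_of_neg_of_pos h2 hC

lemma ten_div_two_add_zero (x : ℂ) (l : ℝ) :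
    ((10 : ℕ) / 2 + x * ((0 : ℤ) : ℂ) / l : ℂ) = 5 := by
  push_cast; norm_num

lemma ten_div_two_sub_zero (x : ℂ) (l : ℝ) :
    ((10 : ℕ) / 2 - x * ((0 : ℤ) : ℂ) / l : ℂ) = 5 := by
  push_cast; norm_num

/-- Outside `(0, 1)` the hypergeometric factor gives the cycle integral for either sign of `ac`. -/
lemma hypTerm₁_eq (hD : ¬ IsSquare D) (hC : C ∈ hypModuli (sqrtPair D) (sqrtPair D))
    (hC' : C ∉ Set.Ioo 0 1) (l l' : ℝ) :
    hypTerm₁ (sqrtPair D) (sqrtPair D) l l' 10 0 0 C =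
      630 * (cycleSum D C 1 + cycleSum D C (-1)) := by
  obtain ⟨h0, h1⟩ := ne_of_mem_hypModuli hD hC
  have key : ∀ α, ∀ q ∈ hypCosets (sqrtPair D) (sqrtPair D) C α,
      hypergeometricPV 5 5 10 (1 / C) / (C : ℂ) ^ 5 = 630 * cycleIntegral D q.out :=
    fun α q hq => cycleIntegral_eq_of_notMem hD (isGeneric_of_modulus hD h0 h1 hq.1) hq.1 hC'
  rw [mul_add, ← mul_hypKloosterman (l := l) (l' := l') (key 1),
    ← mul_hypKloosterman (l := l) (l' := l') (key (-1)), hypTerm₁, ten_div_two_add_zero,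
    ten_div_two_sub_zero]
  push_cast
  ring

lemma hypTerm₂_eq (hD : ¬ IsSquare D) (hC : C ∈ hypModuli (sqrtPair D) (sqrtPair D))
    (hC' : C ∈ Set.Ioo 0 1) (l l' : ℝ) :
    hypTerm₂ (sqrtPair D) (sqrtPair D) l l' 10 0 0 C = 630 * cycleSum D C 1 := by
  obtain ⟨h0, h1⟩ := ne_of_mem_hypModuli hD hC
  have key : ∀ q ∈ hypCosets (sqrtPair D) (sqrtPair D) C 1,
      hypergeometricPV 5 5 10 (1 / C) / (C : ℂ) ^ 5 = 630 * cycleIntegral D q.out :=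
    fun q hq => cycleIntegral_eq_of_pos hD (isGeneric_of_modulus hD h0 h1 hq.1) hq.1
      (ratio_pos_of_mem_hypCosets hC'.1 hq)
  rw [← mul_hypKloosterman (l := l) (l' := l') key, hypTerm₂, ten_div_two_add_zero,
    ten_div_two_sub_zero]
  push_cast
  ring

lemma hypTerm₃_eq (hD : ¬ IsSquare D) (hC : C ∈ hypModuli (sqrtPair D) (sqrtPair D))
    (hC' : C ∈ Set.Ioo 0 1) (l l' : ℝ) :
    hypTerm₃ (sqrtPair D) (sqrtPair D) l l' 10 0 0 C = 630 * cycleSum D C (-1) := by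
  obtain ⟨h0, h1⟩ := ne_of_mem_hypModuli hD hC
  have key : ∀ q ∈ hypCosets (sqrtPair D) (sqrtPair D) C (-1),
      hypergeometricPV 5 5 10 (-1 / (C - 1)) / ((C : ℂ) - 1) ^ 5 = 630 * cycleIntegral D q.out :=
    fun q hq => cycleIntegral_eq_of_neg hD (isGeneric_of_modulus hD h0 h1 hq.1) hq.1
      (ratio_neg_of_mem_hypCosets hC'.1 hq)
  rw [← mul_hypKloosterman (l := l) (l' := l') key, hypTerm₃, ten_div_two_add_zero,
    ten_div_two_add_zero]
  simp only [Int.cast_zero, mul_zero, zero_div, cpow_zero, one_mul]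
  push_cast
  ring

open scoped Classical in
/-- The cycle integrals of the generic double cosets, grouped by the value of `ad`. -/
lemma hasSum_cycleSum (hD : ¬ IsSquare D) :
    HasSum ((hypModuli (sqrtPair D) (sqrtPair D)).indicator
      fun C => cycleSum D C 1 + cycleSum D C (-1))
      (if ∃ γ, IsSwap D γ then 0 else -(sqrtPairLength D : ℂ)) := by
  have h1 := hasSum_subtype_iff_indicator (s := {q : SqrtDoubleCoset D | IsGeneric D q.out})
    (f := fun q : SqrtDoubleCoset D => cycleIntegral D q.out) |>.1 (hasSum_cycleIntegral hD)
  refine (h1.tsum_fiberwise fun q => sqrtScaled D q.out 0 0 * sqrtScaled D q.out 1 1).congr_fun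
    fun C => ?_
  by_cases hC : C ∈ hypModuli (sqrtPair D) (sqrtPair D)
  · rw [Set.indicator_of_mem hC]
    obtain ⟨h2, h3⟩ := ne_of_mem_hypModuli hD hC
    have hf := finite_hypCosets hD hC
    have hdisj : Disjoint (hypCosets (sqrtPair D) (sqrtPair D) C 1)
        (hypCosets (sqrtPair D) (sqrtPair D) C (-1)) := by
      refine Set.disjoint_left.2 fun q hq hq' => ?_
      have := hq.2.symm.trans hq'.2
      exact absurd this (by decide)
    have hset : (fun q : SqrtDoubleCoset D => sqrtScaled D q.out 0 0 * sqrtScaled D q.out 1 1) ⁻¹'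
        {C} = (((hf 1).union (hf (-1))).toFinset : Set (SqrtDoubleCoset D)) := by
      rw [Set.Finite.coe_toFinset]
      ext q
      refine ⟨fun hq => ?_, fun hq => hq.elim (fun h => h.1) fun h => h.1⟩
      have hne := (isGeneric_of_modulus hD h2 h3 hq).ne_zero
      rcases lt_or_gt_of_ne (mul_ne_zero hne.1 hne.2.2.1) with h | h
      · exact Or.inr ⟨hq, sign_eq_neg_one_iff.2 h⟩
      · exact Or.inl ⟨hq, sign_eq_one_iff.2 h⟩
    rw [cycleSum, cycleSum, ← finsum_mem_union hdisj (hf 1) (hf (-1)),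
      finsum_mem_eq_finite_toFinset_sum _ ((hf 1).union (hf (-1)))]
    have hmem : ∀ q ∈ ((hf 1).union (hf (-1))).toFinset,
        sqrtScaled D q.out 0 0 * sqrtScaled D q.out 1 1 = C := fun q hq => by
      rw [Set.Finite.mem_toFinset] at hq
      exact hq.elim (fun h => h.1) fun h => h.1
    rw [hset, Finset.tsum_subtype' _ (Set.indicator {q : SqrtDoubleCoset D | IsGeneric D q.out}
      fun q => cycleIntegral D q.out)]
    refine Finset.sum_congr rfl fun q hq => ?_
    rw [Set.indicator_of_mem]
    exact isGeneric_of_modulus hD h2 h3 (hmem q hq)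
  · rw [Set.indicator_of_notMem hC]
    refine ((tsum_congr fun q => ?_).trans tsum_zero).symm
    exact Set.indicator_of_notMem (fun h => hC ⟨q.1.out, h, q.2⟩) _

lemma summable_hypTerm₁ (hD : ¬ IsSquare D) (l l' : ℝ) :
    Summable fun C : {C : ℝ // C ∈ hypModuli (sqrtPair D) (sqrtPair D) ∧ C ∉ Set.Ioo 0 1} =>
      hypTerm₁ (sqrtPair D) (sqrtPair D) l l' 10 0 0 C := by
  refine (((hasSum_cycleSum hD).summable.subtype {C : ℝ | C ∈ hypModuli (sqrtPair D) (sqrtPair D) ∧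
    C ∉ Set.Ioo 0 1}).mul_left 630).congr fun C => ?_
  rw [hypTerm₁_eq hD C.2.1 C.2.2, Function.comp_apply, Set.indicator_of_mem C.2.1]

open scoped Classical in
lemma tsum_hypTerm (hD : ¬ IsSquare D) (l l' : ℝ) :
    (∑' C : {C : ℝ // C ∈ hypModuli (sqrtPair D) (sqrtPair D) ∧ C ∉ Set.Ioo 0 1},
        hypTerm₁ (sqrtPair D) (sqrtPair D) l l' 10 0 0 C) +
      (∑' C : {C : ℝ // C ∈ hypModuli (sqrtPair D) (sqrtPair D) ∧ C ∈ Set.Ioo 0 1},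
        hypTerm₂ (sqrtPair D) (sqrtPair D) l l' 10 0 0 C) +
      (∑' C : {C : ℝ // C ∈ hypModuli (sqrtPair D) (sqrtPair D) ∧ C ∈ Set.Ioo 0 1},
        hypTerm₃ (sqrtPair D) (sqrtPair D) l l' 10 0 0 C) =
      630 * if ∃ γ, IsSwap D γ then 0 else -(sqrtPairLength D : ℂ) := by
  set M := hypModuli (sqrtPair D) (sqrtPair D) with hM
  have : Finite {C : ℝ // C ∈ M ∧ C ∈ Set.Ioo 0 1} := finite_hypModuli_inter_Ioo hD
  have hsum := hasSum_cycleSum hD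
  have h1 := hsum.summable.tsum_subtype_add_tsum_subtype_compl {C | C ∈ M ∧ C ∉ Set.Ioo 0 1}
  have h2 : ∑' C : ↥{C | C ∈ M ∧ C ∉ Set.Ioo 0 1}ᶜ,
      M.indicator (fun C => cycleSum D C 1 + cycleSum D C (-1)) C =
        ∑' C : {C : ℝ // C ∈ M ∧ C ∈ Set.Ioo 0 1}, (cycleSum D C 1 + cycleSum D C (-1)) := by
    refine Eq.trans ?_ (tsum_subtype {C | C ∈ M ∧ C ∈ Set.Ioo 0 1} fun C =>
      cycleSum D C 1 + cycleSum D C (-1)).symm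
    rw [tsum_subtype]
    refine tsum_congr fun C => ?_
    by_cases hC : C ∈ M <;> by_cases hC' : C ∈ Set.Ioo (0 : ℝ) 1 <;>
      simp [Set.indicator, hC, hC', -Set.mem_Ioo]
  rw [hsum.tsum_eq, h2, Summable.tsum_add .of_finite .of_finite] at h1
  rw [← h1, mul_add, mul_add, ← tsum_mul_left, ← tsum_mul_left, ← tsum_mul_left, ← add_assoc]
  congr 1
  · congr 1
    · refine tsum_congr fun C => ?_
      rw [hypTerm₁_eq hD C.2.1 C.2.2, Set.indicator_of_mem C.2.1]
    · exact tsum_congr fun C => hypTerm₂_eq hD C.2.1 C.2.2 l l'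
  · exact tsum_congr fun C => hypTerm₃_eq hD C.2.1 C.2.2 l l'

open scoped Classical in
lemma Phi_eq (hD : ¬ IsSquare D) : Phi D = if ∃ γ, IsSwap D γ then 0 else -1 := by
  have hL : (sqrtPairLength D : ℂ) ≠ 0 := by exact_mod_cast (sqrtPairLength_pos hD).ne'
  rw [Phi, hypCoeffSum, tsum_hypTerm hD, ten_div_two_add_zero, ten_div_two_sub_zero,
    betaFn_five_five, Int.cast_zero, mul_zero, zero_div, Complex.exp_zero]
  split_ifs
  · simp
  · field_simp

end Moduli

end

theorem proposition8p18 (D : ℕ) (hD : ¬ IsSquare D) :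
    -- the sums that define `Φ(D)` converge, and two of them are finite
    (∀ C ∈ hypModuli (sqrtPair D) (sqrtPair D), ∀ α : SignType,
      (hypCosets (sqrtPair D) (sqrtPair D) C α).Finite) ∧
    (hypModuli (sqrtPair D) (sqrtPair D) ∩ Set.Ioo 0 1).Finite ∧
    (Summable fun C : {C : ℝ // C ∈ hypModuli (sqrtPair D) (sqrtPair D) ∧ C ∉ Set.Ioo 0 1} =>
      hypTerm₁ (sqrtPair D) (sqrtPair D) (sqrtPairLength D) (sqrtPairLength D) 10 0 0 C) ∧
    -- the values of `Φ(D)` and the negative Pell equation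
    (Phi D = 0 ∨ Phi D = -1) ∧
    ((∃ x y : ℤ, x ^ 2 - D * y ^ 2 = -1) ↔ Phi D = 0) := by
  refine ⟨fun C hC α => finite_hypCosets hD hC α, finite_hypModuli_inter_Ioo hD,
    summable_hypTerm₁ hD _ _, ?_, ?_⟩
  · rw [Phi_eq hD]
    split_ifs
    · exact Or.inl rfl
    · exact Or.inr rfl
  · rw [← exists_isSwap_iff, Phi_eq hD]
    split_ifs with h <;> simp [h]
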